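/- **Setting.** Let $d\ge 1$ be an integer. A weighted polynomial congestion game $\Gamma$ of degree $d$ has a finite nonempty set $N$ of $n$ players, a finite set $E$ of resources, a weight $w_u>0$ and a nonempty set $S_u\subseteq 2^E$ of strategies for each player $u$, and for each resource $e$ a cost function $c_e$ that is a polynomial of degree at most $d$ with nonnegative coefficients. In a state $\mathbf s\in\prod_u S_u$ the cost of $u$ is $C_u(\mathbf s)=w_u\sum_{e\in s_u}c_e(x_e(\mathbf s))$, where $x_e(\mathbf s)=\sum_{v:\,e\in s_v}w_v$. For a real $\rho$, player $u$ has a $\rho$-move in $\mathbf s$ if $C_u(\mathbf s)>\rho\, C_u(\mathbf s_{-u},s_u')$ for some $s'_u\in S_u$; a state in which no player has a $\rho$-move is a $\rho$-approximate (pure Nash) equilibrium. Put $\alpha=d+1$ and $p=(2d+3)(d+1)(4d)^{d+1}$. **Algorithm 1.** Input: a game $\Gamma$ as above and a state $\mathbf s_{\rm init}$. Let $c_{\max}=\max_{u}C_u(\mathbf s_{\rm init})$, let $c_{\min}$ be the minimum, over all players $u$ and all $s_u\in S_u$, of the cost of $u$ when she plays $s_u$ and all other players use the empty set, and assume $c_{\min}>0$.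 Let $m=\lceil\log(c_{\max}/c_{\min})\rceil$ (the base of the logarithm may be any number in $(1,10]$), $g=np^3(1+m(1+p))^dd^d+1$ and $b_i=g^{-i}c_{\max}$. Start with $\mathbf s=\mathbf s_{\rm init}$ and $F=\emptyset$. * Phase $0$: while some player $u$ has $C_u(\mathbf s)\ge b_1$ and an $(\alpha+\frac1p)$-move, choose such a $u$ and replace her strategy by a best response to $\mathbf s_{-u}$. * Phase $i$, for $i=1,\dots,m-1$: while some player $u\notin F$ has either $C_u(\mathbf s)\in[b_{i+1},b_i)$ and an $(\alpha+\frac1p)$-move, or $C_u(\mathbf s)\ge b_i$ and a $p$-move, choose such a $u$ and replace her strategy by a best response to $\mathbf s_{-u}$. Then add to $F$ all players $u\notin F$ with $C_u(\mathbf s)\ge b_i$. * Finally add to $F$ all players $u\notin F$ with $C_u(\mathbf s)\ge b_m$, and return $\mathbf s$. The choices of the moving player and of her best response are arbitrary. **Theorem.** For all such $d$, $\Gamma$ and $\mathbf s_{\rm init}$, every execution of Algorithm 1 terminates (and there is one), and every state $\mathbf s$ that it can return is a $\rho_d$-approximate pure Nash equilibrium of $\Gamma$ with $$\rho_d=\frac{1+3/p}{1-2/p}\cdot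 p ,$$ that is, $C_u(\mathbf s)\le\rho_d\,C_u(\mathbf s_{-u},s'_u)$ for all players $u$ and all $s'_u\in S_u$. Moreover $\rho_d=d^{\,d+o(d)}$: there is a function $\varepsilon:\mathbb N\to\mathbb R$ with $\varepsilon(d)/d\to0$ as $d\to\infty$ and $\rho_d=d^{\,d+\varepsilon(d)}$ for all $d\ge2$. -/

import Mathlib

open Filter Asymptotics

/-- A weighted polynomial congestion game of degree (at most) `d` with players `N` and
resources `E`. -/
structure CongestionGame (d : ℕ) (N E : Type*) where
  /-- The weights of the players. -/
  weight : N → ℝ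
  weight_pos : ∀ u, 0 < weight u
  /-- The strategy sets; a strategy is a set of resources. -/
  strategies : N → Finset (Finset E)
  strategies_nonempty : ∀ u, (strategies u).Nonempty
  /-- The cost functions of the resources. -/
  costFn : E → Polynomial ℝ
  costFn_natDegree_le : ∀ e, (costFn e).natDegree ≤ d
  costFn_coeff_nonneg : ∀ e i, 0 ≤ (costFn e).coeff i

namespace CongestionGame

noncomputable section

variable {d : ℕ} {N E : Type*} [Fintype N] [DecidableEq N] [DecidableEq E]

/-- A profile `s : N → Finset E` is a state of the game if every player uses one of her own
strategies. (The fictitious empty state `fun _ => ∅` is a profile, but usually not a state.) -/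
def IsState (G : CongestionGame d N E) (s : N → Finset E) : Prop :=
  ∀ u, s u ∈ G.strategies u

/-- The total weight of the players that use the resource `e` in the profile `s`. -/
def load (G : CongestionGame d N E) (s : N → Finset E) (e : E) : ℝ :=
  ∑ v with e ∈ s v, G.weight v

/-- The cost `C_u(s)` of the player `u` in the profile `s`. -/
def cost (G : CongestionGame d N E) (s : N → Finset E) (u : N) : ℝ :=
  G.weight u * ∑ e ∈ s u, (G.costFn e).eval (G.load s e)

/-- The cost of the player `u` after her unilateral deviation from `s` to the strategy `t`. -/
def devCost (G : CongestionGame d N E) (s : N → Finset E) (u : N) (t : Finset E) : ℝ :=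
  G.cost (Function.update s u t) u

/-- `t` is a best response of the player `u` to the strategies of the others in `s`. -/
def IsBestResponse (G : CongestionGame d N E) (s : N → Finset E) (u : N) (t : Finset E) : Prop :=
  t ∈ G.strategies u ∧ ∀ t' ∈ G.strategies u, G.devCost s u t ≤ G.devCost s u t'

/-- The player `u` has a `ρ`-move in `s`. -/
def HasMove (G : CongestionGame d N E) (ρ : ℝ) (s : N → Finset E) (u : N) : Prop :=
  ∃ t ∈ G.strategies u, ρ * G.devCost s u t < G.cost s u

/-- `s` is a `ρ`-approximate (pure Nash) equilibrium. -/
def IsApproxEquilibrium (G : CongestionGame d N E) (ρ : ℝ) (s : N → Finset E) : Prop :=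
  G.IsState s ∧ ∀ u, ∀ t ∈ G.strategies u, G.cost s u ≤ ρ * G.devCost s u t

/-- The cost of a best response of the player `u` to the strategies of the others in `s`. -/
def bestCost (G : CongestionGame d N E) (s : N → Finset E) (u : N) : ℝ :=
  (G.strategies u).inf' (G.strategies_nonempty u) (G.devCost s u)

/-- `c_max`: the maximum cost of a player in the initial state. -/
def cMax [Nonempty N] (G : CongestionGame d N E) (sInit : N → Finset E) : ℝ :=
  Finset.univ.sup' Finset.univ_nonempty (G.cost sInit)

/-- `c_min`: the minimum over the players of the cost of a best response to the empty state. -/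
def cMin [Nonempty N] (G : CongestionGame d N E) : ℝ :=
  Finset.univ.inf' Finset.univ_nonempty (G.bestCost fun _ => ∅)

/-- `α = d + 1`. -/
def alpha (d : ℕ) : ℝ := d + 1

/-- `p = (2d+3)(d+1)(4d)^(d+1)`. -/
def pParam (d : ℕ) : ℝ := (2 * d + 3) * (d + 1) * (4 * d) ^ (d + 1)

/-- The approximation factor `(1 + 3/p) / (1 - 2/p) * p`. -/
def approxFactor (d : ℕ) : ℝ :=
  (1 + 3 / pParam d) / (1 - 2 / pParam d) * pParam d

/-- The number `m` of phases: the logarithm of `c_max / c_min` to the base `β`, rounded up. -/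
def numPhases [Nonempty N] (G : CongestionGame d N E) (β : ℝ) (sInit : N → Finset E) : ℕ :=
  ⌈Real.logb β (G.cMax sInit / G.cMin)⌉₊

/-- `g = n p³ (1 + m (1 + p))^d d^d + 1`. -/
def gParam [Nonempty N] (G : CongestionGame d N E) (β : ℝ) (sInit : N → Finset E) : ℝ :=
  Fintype.card N * pParam d ^ 3 * (1 + G.numPhases β sInit * (1 + pParam d)) ^ d * (d : ℝ) ^ d + 1

/-- The boundary `b_i = g^(-i) c_max`. -/
def boundary [Nonempty N] (G : CongestionGame d N E) (β : ℝ) (sInit : N → Finset E)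
    (i : ℕ) : ℝ :=
  (G.gParam β sInit ^ i)⁻¹ * G.cMax sInit

/-- The condition of the while loop of phase `i`: the player `u` may be selected to move when the
current state is `s` and the current set of fixed players is `F`. -/
def Selectable [Nonempty N] (G : CongestionGame d N E) (β : ℝ) (sInit : N → Finset E) :
    ℕ → (N → Finset E) → Set N → N → Prop
  | 0, s, _, u =>
      G.boundary β sInit 1 ≤ G.cost s u ∧ G.HasMove (alpha d + 1 / pParam d) s u
  | i + 1, s, F, u => u ∉ F ∧
      ((G.boundary β sInit (i + 2) ≤ G.cost s u ∧ G.cost s u < G.boundary β sInit (i + 1) ∧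
          G.HasMove (alpha d + 1 / pParam d) s u) ∨
        (G.boundary β sInit (i + 1) ≤ G.cost s u ∧ G.HasMove (pParam d) s u))

/-- The set of fixed players after adding all players whose cost in `s` is at least `b_i`. -/
def addFixed [Nonempty N] (G : CongestionGame d N E) (β : ℝ) (sInit : N → Finset E)
    (i : ℕ) (s : N → Finset E) (F : Set N) : Set N :=
  F ∪ {u | u ∉ F ∧ G.boundary β sInit i ≤ G.cost s u}

/-- The set of fixed players after the end of phase `i`; phase `0` fixes nobody. -/
def fixedAfter [Nonempty N] (G : CongestionGame d N E) (β : ℝ) (sInit : N → Finset E) :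
    ℕ → (N → Finset E) → Set N → Set N
  | 0, _, F => F
  | i + 1, s, F => G.addFixed β sInit (i + 1) s F

/-- The configurations of the algorithm: `running i s F` is a configuration within phase `i` with
current state `s` and set of fixed players `F`; in `halted s F` the algorithm has terminated and
returned `s`. -/
inductive Config (N E : Type*) where
  | running (i : ℕ) (s : N → Finset E) (F : Set N) : Config N E
  | halted (s : N → Finset E) (F : Set N) : Config N E

/-- One step of the algorithm. The choice of the selectable player and of her best response is
arbitrary. -/
inductive Step [Nonempty N] (G : CongestionGame d N E) (β : ℝ) (sInit : N → Finset E) :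
    Config N E → Config N E → Prop where
  | move (i : ℕ) (s : N → Finset E) (F : Set N) (u : N) (t : Finset E)
      (hu : G.Selectable β sInit i s F u) (ht : G.IsBestResponse s u t) :
      Step G β sInit (.running i s F) (.running i (Function.update s u t) F)
  | nextPhase (i : ℕ) (s : N → Finset E) (F : Set N)
      (hs : ∀ u, ¬ G.Selectable β sInit i s F u) (hi : i + 1 < G.numPhases β sInit) :
      Step G β sInit (.running i s F) (.running (i + 1) s (G.fixedAfter β sInit i s F))
  | halt (i : ℕ) (s : N → Finset E) (F : Set N)
      (hs : ∀ u, ¬ G.Selectable β sInit i s F u) (hi : G.numPhases β sInit ≤ i + 1) :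
      Step G β sInit (.running i s F) (.halted s
        (G.addFixed β sInit (G.numPhases β sInit) s (G.fixedAfter β sInit i s F)))

/-- Every execution of the algorithm from the initial state `sInit` is finite. -/
def Terminates [Nonempty N] (G : CongestionGame d N E) (β : ℝ) (sInit : N → Finset E) : Prop :=
  Acc (fun c' c => G.Step β sInit c c') (.running 0 sInit ∅)

/-- Some execution of the algorithm from the initial state `sInit` returns the state `s`. -/
def Returns [Nonempty N] (G : CongestionGame d N E) (β : ℝ) (sInit s : N → Finset E) : Prop :=
  ∃ F : Set N, Relation.ReflTransGen (G.Step β sInit) (.running 0 sInit ∅) (.halted s F)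

end

end CongestionGame

set_option linter.unusedSectionVars false

/-! Weighted games need not have an exact potential, so the proof uses an approximate one: the sum
over resources of the integral of the cost function from 0 to the load. Adding players to a resource
raises this integral by at most their weight times the final cost per unit, and by at least a
1/(d+1) fraction of that product. Hence a move by a factor above d+1 strictly decreases the
potential, and since there are finitely many profiles, each phase terminates.

The core is an estimate of one phase with boundary b (`PhaseInv.exists_sum_cost_le`): the players R
that move in it have total cost O((d+1)(4d)^d n b) at its start, and at most d+1 times that bound at
its end. Two relations between these totals are played against each other. At the start every player
of R is cheaper than b or has no (α+1/p)-move, so the start total is controlled by the deviation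
costs to the final strategies, hence by n b, a large multiple of the end total and a fraction below
1 of the start total itself. Conversely, at the end the cost just after a last move is at most
b/(d+1), or was paid for by a potential drop about p/(d+1) times as large; the available potential
is at most the start total, so the excess is tiny because p is huge.

A player is fixed when she has no p-move and cost at least the current boundary. Later movers have
total cost far below that boundary, since consecutive boundaries differ by the factor g. A load
change that is small relative to the player's weight alters her costs by a factor 1+γ per degree; a
large one is charged to the movers' total cost. The factors multiply to at most 1+1/p over all
phases and the additive errors telescope along the boundaries, so her p-approximation degrades only
to ρ_d. Players never fixed have cost at least c_min, hence at least the next boundary, and so no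
(α+1/p)-move. -/

/-! ### Inequalities for polynomials with nonnegative coefficients -/

/-- The antiderivative of a real polynomial that vanishes at `0`, as a function. -/
noncomputable def Polynomial.antideriv (P : Polynomial ℝ) (x : ℝ) : ℝ :=
  ∑ i ∈ P.support, P.coeff i * (x ^ (i + 1) / (i + 1))

theorem pow_succ_sub_pow_succ_le {x y : ℝ} (hy : 0 ≤ y) (hxy : y ≤ x) (i : ℕ) :
    x ^ (i + 1) - y ^ (i + 1) ≤ (i + 1) * ((x - y) * x ^ i) := by
  induction i with
  | zero => simp
  | succ i ih =>
    have h1 : y ^ (i + 1) ≤ x ^ (i + 1) := pow_le_pow_left₀ hy hxy _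
    have h2 := mul_le_mul_of_nonneg_left ih (hy.trans hxy)
    have h3 := mul_le_mul_of_nonneg_left h1 (sub_nonneg.2 hxy)
    push_cast
    calc x ^ (i + 1 + 1) - y ^ (i + 1 + 1)
        = x * (x ^ (i + 1) - y ^ (i + 1)) + (x - y) * y ^ (i + 1) := by ring
      _ ≤ x * ((i + 1) * ((x - y) * x ^ i)) + (x - y) * x ^ (i + 1) := add_le_add h2 h3
      _ = _ := by ring

namespace Polynomial

variable {d : ℕ} {P : Polynomial ℝ}

theorem eval_nonneg_of_coeff_nonneg (hP : ∀ i, 0 ≤ P.coeff i) {x : ℝ} (hx : 0 ≤ x) :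
    0 ≤ P.eval x := by
  rw [eval_eq_sum, Polynomial.sum]
  exact Finset.sum_nonneg fun i _ => mul_nonneg (hP i) (pow_nonneg hx i)

theorem eval_mono_of_coeff_nonneg (hP : ∀ i, 0 ≤ P.coeff i) {x y : ℝ} (hx : 0 ≤ x)
    (hxy : x ≤ y) : P.eval x ≤ P.eval y := by
  simp only [eval_eq_sum, Polynomial.sum]
  exact Finset.sum_le_sum fun i _ =>
    mul_le_mul_of_nonneg_left (pow_le_pow_left₀ hx hxy i) (hP i)

theorem eval_le_pow_mul_eval (hd : P.natDegree ≤ d) (hP : ∀ i, 0 ≤ P.coeff i) {x y k : ℝ}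
    (hx : 0 ≤ x) (hy : 0 ≤ y) (hk : 1 ≤ k) (hxy : x ≤ k * y) :
    P.eval x ≤ k ^ d * P.eval y := by
  simp only [eval_eq_sum, Polynomial.sum, Finset.mul_sum]
  refine Finset.sum_le_sum fun i hi => ?_
  have hid : i ≤ d := (le_natDegree_of_mem_supp i hi).trans hd
  calc P.coeff i * x ^ i ≤ P.coeff i * (k ^ d * y ^ i) := by
        refine mul_le_mul_of_nonneg_left ?_ (hP i)
        calc x ^ i ≤ (k * y) ^ i := pow_le_pow_left₀ hx hxy i
          _ = k ^ i * y ^ i := mul_pow ..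
          _ ≤ k ^ d * y ^ i :=
            mul_le_mul_of_nonneg_right (pow_le_pow_right₀ hk hid) (pow_nonneg hy i)
    _ = _ := by ring

theorem antideriv_sub_le (hP : ∀ i, 0 ≤ P.coeff i) {x y : ℝ} (hy : 0 ≤ y) (hxy : y ≤ x) :
    P.antideriv x - P.antideriv y ≤ (x - y) * P.eval x := by
  simp only [eval_eq_sum, Polynomial.sum, antideriv, Finset.mul_sum, ← Finset.sum_sub_distrib]
  refine Finset.sum_le_sum fun i _ => ?_
  have h0 : (0 : ℝ) < i + 1 := by positivity
  have h : (x ^ (i + 1) - y ^ (i + 1)) / (i + 1) ≤ (x - y) * x ^ i := by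
    rw [div_le_iff₀' h0]; exact pow_succ_sub_pow_succ_le hy hxy i
  have := mul_le_mul_of_nonneg_left h (hP i)
  calc _ = P.coeff i * ((x ^ (i + 1) - y ^ (i + 1)) / (i + 1)) := by ring
    _ ≤ _ := this
    _ = _ := by ring

/-- Termwise, (x - y) x^i is at most x^(i+1) - y^(i+1), which is i+1 ≤ d+1 times the increment of
the antiderivative. This is the source of α = d+1. -/
theorem mul_eval_le_antideriv_sub (hd : P.natDegree ≤ d) (hP : ∀ i, 0 ≤ P.coeff i) {x y : ℝ}
    (hy : 0 ≤ y) (hxy : y ≤ x) :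
    (x - y) * P.eval x ≤ (d + 1) * (P.antideriv x - P.antideriv y) := by
  simp only [eval_eq_sum, Polynomial.sum, antideriv, Finset.mul_sum, ← Finset.sum_sub_distrib]
  refine Finset.sum_le_sum fun i hi => ?_
  have hid : (i : ℝ) ≤ d := by exact_mod_cast (le_natDegree_of_mem_supp i hi).trans hd
  have h0 : (0 : ℝ) < i + 1 := by positivity
  have h1 : (x - y) * x ^ i ≤ x ^ (i + 1) - y ^ (i + 1) := by
    have := mul_le_mul_of_nonneg_left (pow_le_pow_left₀ hy hxy i) hy
    rw [pow_succ', pow_succ']; linarith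
  have h2 : 0 ≤ x ^ (i + 1) - y ^ (i + 1) := sub_nonneg.2 (pow_le_pow_left₀ hy hxy _)
  have h3 : (x - y) * x ^ i ≤ (d + 1) * ((x ^ (i + 1) - y ^ (i + 1)) / (i + 1)) := by
    refine h1.trans ?_
    rw [mul_div_assoc', le_div_iff₀ h0, mul_comm]
    exact mul_le_mul_of_nonneg_right (by linarith) h2
  calc _ = P.coeff i * ((x - y) * x ^ i) := by ring
    _ ≤ _ := mul_le_mul_of_nonneg_left h3 (hP i)
    _ = _ := by ring

/-- Either a ≤ t b, and the full load is at most 1+t times z+b, or b ≤ a/t, and it is at most 1+1/t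
times z+a. The parameter t makes the coefficient of the second term small at the expense of the
first. -/
theorem mul_eval_add_le (hd : P.natDegree ≤ d) (hP : ∀ i, 0 ≤ P.coeff i) {z a b t : ℝ}
    (hz : 0 ≤ z) (ha : 0 ≤ a) (hb : 0 ≤ b) (ht : 0 < t) :
    b * P.eval (z + a + b) ≤
      (1 + t) ^ d * (b * P.eval (z + b)) + (1 + 1 / t) ^ d / t * (a * P.eval (z + a)) := by
  have h1 := eval_nonneg_of_coeff_nonneg hP (add_nonneg hz ha)
  have h2 := eval_nonneg_of_coeff_nonneg hP (add_nonneg hz hb)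
  rcases le_total a (t * b) with h | h
  · have h3 : P.eval (z + a + b) ≤ (1 + t) ^ d * P.eval (z + b) :=
      eval_le_pow_mul_eval hd hP (by positivity) (by positivity) (by linarith)
        (by nlinarith [mul_nonneg ht.le hz])
    have h4 : 0 ≤ (1 + 1 / t) ^ d / t * (a * P.eval (z + a)) := by positivity
    nlinarith [mul_le_mul_of_nonneg_left h3 hb]
  · have hba : b ≤ a / t := by rw [le_div_iff₀ ht]; linarith
    have h5 : z + a + b ≤ (1 + 1 / t) * (z + a) := by
      have : 0 ≤ z / t := by positivity
      calc z + a + b ≤ z + a + a / t := by linarith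
        _ ≤ z + a + a / t + z / t := by linarith
        _ = _ := by ring
    have h3 : P.eval (z + a + b) ≤ (1 + 1 / t) ^ d * P.eval (z + a) :=
      eval_le_pow_mul_eval hd hP (by positivity) (by positivity)
        (by have : 0 < 1 / t := by positivity
            linarith) h5
    have h4 : 0 ≤ (1 + t) ^ d * (b * P.eval (z + b)) := by positivity
    calc b * P.eval (z + a + b) ≤ a / t * ((1 + 1 / t) ^ d * P.eval (z + a)) :=
          mul_le_mul hba h3 (eval_nonneg_of_coeff_nonneg hP (by positivity)) (by positivity)
      _ = (1 + 1 / t) ^ d / t * (a * P.eval (z + a)) := by ring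
      _ ≤ _ := by linarith

/-- If the added load y is at most γ w, the load grows by a factor at most 1+γ because w ≤ x.
Otherwise w < y/γ, and the whole cost is charged to the newcomers. -/
theorem mul_eval_le_of_load_increase (hd : P.natDegree ≤ d) (hP : ∀ i, 0 ≤ P.coeff i)
    {w x x' y γ : ℝ} (hw : 0 < w) (hwx : w ≤ x) (hx' : 0 ≤ x') (hy : 0 ≤ y) (hxy : x' ≤ x + y)
    (hγ : 0 < γ) :
    w * P.eval x' ≤ (1 + γ) ^ d * (w * P.eval x) + 1 / γ * (y * P.eval x') := by
  have h1 := eval_nonneg_of_coeff_nonneg hP hx'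
  have h2 := eval_nonneg_of_coeff_nonneg hP (hw.le.trans hwx)
  rcases le_total y (γ * w) with h | h
  · have h3 : P.eval x' ≤ (1 + γ) ^ d * P.eval x :=
      eval_le_pow_mul_eval hd hP hx' (hw.le.trans hwx) (by linarith) (by nlinarith)
    have h4 : 0 ≤ 1 / γ * (y * P.eval x') := by positivity
    nlinarith [mul_le_mul_of_nonneg_left h3 hw.le]
  · have h3 : w ≤ 1 / γ * y := by
      rw [one_div, ← div_eq_inv_mul, le_div_iff₀ hγ]; linarith
    have h4 : 0 ≤ (1 + γ) ^ d * (w * P.eval x) := by positivity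
    nlinarith [mul_le_mul_of_nonneg_right h3 h1]

/-- A lost load y ≤ γ w is again a factor 1+γ. Otherwise w and X are bounded by multiples of the old
load x, and the loss X^i - X'^i, which is at most i y X^(i-1), is charged to the cost y P(x) of
those who may leave. -/
theorem mul_eval_le_of_load_decrease (hd : P.natDegree ≤ d) (hP : ∀ i, 0 ≤ P.coeff i)
    {w x y X X' γ : ℝ} (hw : 0 < w) (hy : 0 ≤ y) (hyx : y ≤ x) (hX : 0 ≤ X) (hwX' : w ≤ X')
    (hXx : X ≤ x + w) (hXX' : X ≤ X' + y) (hγ : 0 < γ) (hγ1 : γ ≤ 1) :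
    w * P.eval X ≤ (1 + γ) ^ d * (w * P.eval X') +
      d * (1 + γ) ^ d * (1 / γ) ^ d * (y * P.eval x) := by
  have hX' : 0 ≤ X' := hw.le.trans hwX'
  have hx : 0 ≤ x := hy.trans hyx
  have h1 := eval_nonneg_of_coeff_nonneg hP hX'
  have h2 := eval_nonneg_of_coeff_nonneg hP hx
  rcases le_total y (γ * w) with h | h
  · have h3 : P.eval X ≤ (1 + γ) ^ d * P.eval X' :=
      eval_le_pow_mul_eval hd hP hX hX' (by linarith) (by nlinarith)
    have h4 : 0 ≤ d * (1 + γ) ^ d * (1 / γ) ^ d * (y * P.eval x) := by positivity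
    nlinarith [mul_le_mul_of_nonneg_left h3 hw.le]
  · have hwx : w ≤ 1 / γ * x := by
      rw [one_div, ← div_eq_inv_mul, le_div_iff₀ hγ]; linarith
    have hγ' : 1 ≤ 1 / γ := by rw [le_div_iff₀ hγ]; linarith
    have hG : 1 ≤ (1 + γ) ^ d := one_le_pow₀ (by linarith)
    suffices hs : w * P.eval X ≤ w * P.eval X' +
        d * (1 + γ) ^ d * (1 / γ) ^ d * (y * P.eval x) by
      nlinarith [mul_nonneg hw.le h1]
    simp only [eval_eq_sum, Polynomial.sum, Finset.mul_sum, ← Finset.sum_add_distrib]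
    refine Finset.sum_le_sum fun i hi => ?_
    have hid : i ≤ d := (le_natDegree_of_mem_supp i hi).trans hd
    have key : w * X ^ i ≤ w * X' ^ i + d * (1 + γ) ^ d * (1 / γ) ^ d * (y * x ^ i) := by
      rcases le_total X X' with hle | hle
      · have := mul_le_mul_of_nonneg_left (pow_le_pow_left₀ hX hle i) hw.le
        have : 0 ≤ d * (1 + γ) ^ d * (1 / γ) ^ d * (y * x ^ i) := by positivity
        linarith
      · rcases i with _ | i
        · have : 0 ≤ d * (1 + γ) ^ d * (1 / γ) ^ d * (y * x ^ 0) := by positivity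
          simpa using this
        · have e1 := pow_succ_sub_pow_succ_le hX' hle i
          have hXb : X ≤ (1 + γ) * (1 / γ) * x := by
            have : (1 + γ) * (1 / γ) * x = x + 1 / γ * x := by field_simp; ring
            linarith
          have e2 : w * ((i + 1) * ((X - X') * X ^ i)) ≤
              1 / γ * x * (d * (y * ((1 + γ) * (1 / γ) * x) ^ i)) := by
            have hi1 : ((i : ℝ) + 1) ≤ d := by exact_mod_cast hid
            gcongr
            linarith
          have e3 : 1 / γ * x * (d * (y * ((1 + γ) * (1 / γ) * x) ^ i)) =
              d * (1 + γ) ^ i * (1 / γ) ^ (i + 1) * (y * x ^ (i + 1)) := by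
            rw [mul_pow, mul_pow]; ring
          have e4 : d * (1 + γ) ^ i * (1 / γ) ^ (i + 1) * (y * x ^ (i + 1)) ≤
              d * (1 + γ) ^ d * (1 / γ) ^ d * (y * x ^ (i + 1)) := by
            gcongr
            · linarith
            · omega
          nlinarith [mul_le_mul_of_nonneg_left e1 hw.le]
    calc w * (P.coeff i * X ^ i) = P.coeff i * (w * X ^ i) := by ring
      _ ≤ P.coeff i * (w * X' ^ i + d * (1 + γ) ^ d * (1 / γ) ^ d * (y * x ^ i)) :=
        mul_le_mul_of_nonneg_left key (hP i)
      _ = _ := by ring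

end Polynomial

/-! ### Partial loads, the approximate potential, and the effect of a group of movers on costs -/

namespace CongestionGame

noncomputable section

variable {d : ℕ} {N E : Type*} [Fintype N] [DecidableEq N] [DecidableEq E]

/-- The total weight of the players in `A` that use the resource `e` in the profile `s`. -/
def loadOn (G : CongestionGame d N E) (A : Finset N) (s : N → Finset E) (e : E) : ℝ :=
  ∑ v ∈ A with e ∈ s v, G.weight v

variable (G : CongestionGame d N E) {A B R : Finset N} {s s' : N → Finset E} {u : N}
  {t : Finset E} {e : E} {γ D b : ℝ}

theorem load_eq_loadOn_univ : G.load s e = G.loadOn Finset.univ s e := rfl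

theorem loadOn_nonneg : 0 ≤ G.loadOn A s e :=
  Finset.sum_nonneg fun v _ => (G.weight_pos v).le

theorem load_nonneg : 0 ≤ G.load s e := G.loadOn_nonneg

theorem loadOn_mono (h : A ⊆ B) : G.loadOn A s e ≤ G.loadOn B s e :=
  Finset.sum_le_sum_of_subset_of_nonneg (Finset.filter_subset_filter _ h)
    fun v _ _ => (G.weight_pos v).le

theorem loadOn_le_load : G.loadOn A s e ≤ G.load s e := G.loadOn_mono (Finset.subset_univ A)

theorem loadOn_congr (h : ∀ v ∈ A, s v = s' v) : G.loadOn A s e = G.loadOn A s' e := by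
  simp only [loadOn, Finset.sum_filter]
  exact Finset.sum_congr rfl fun v hv => by rw [h v hv]

theorem loadOn_sdiff_add (h : B ⊆ A) : G.loadOn (A \ B) s e + G.loadOn B s e = G.loadOn A s e := by
  simp only [loadOn, Finset.sum_filter]
  exact Finset.sum_sdiff h

theorem loadOn_singleton : G.loadOn {u} s e = if e ∈ s u then G.weight u else 0 := by
  simp [loadOn, Finset.sum_filter]

theorem load_eq_compl_add : G.load s e = G.loadOn Rᶜ s e + G.loadOn R s e := by
  rw [load_eq_loadOn_univ, ← G.loadOn_sdiff_add (Finset.subset_univ R), Finset.compl_eq_univ_sdiff]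

theorem weight_le_loadOn (hu : u ∈ A) (he : e ∈ s u) : G.weight u ≤ G.loadOn A s e :=
  Finset.single_le_sum (f := G.weight) (fun v _ => (G.weight_pos v).le)
    (Finset.mem_filter.2 ⟨hu, he⟩)

theorem sum_weight_mul_sum [Fintype E] (f : E → ℝ) :
    ∑ u ∈ A, G.weight u * ∑ e ∈ s u, f e = ∑ e, G.loadOn A s e * f e := by
  simp only [loadOn, Finset.sum_filter, Finset.sum_mul, Finset.mul_sum]
  rw [Finset.sum_comm]
  refine Finset.sum_congr rfl fun u _ => ?_
  simp [ite_mul]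

/-- The potential of the players in `A`. -/
def pot [Fintype E] (A : Finset N) (s : N → Finset E) : ℝ :=
  ∑ e, (G.costFn e).antideriv (G.loadOn A s e)

theorem eval_costFn_nonneg {x : ℝ} (hx : 0 ≤ x) : 0 ≤ (G.costFn e).eval x :=
  Polynomial.eval_nonneg_of_coeff_nonneg (G.costFn_coeff_nonneg e) hx

theorem eval_costFn_mono {x y : ℝ} (hx : 0 ≤ x) (hxy : x ≤ y) :
    (G.costFn e).eval x ≤ (G.costFn e).eval y :=
  Polynomial.eval_mono_of_coeff_nonneg (G.costFn_coeff_nonneg e) hx hxy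

theorem cost_nonneg : 0 ≤ G.cost s u :=
  mul_nonneg (G.weight_pos u).le
    (Finset.sum_nonneg fun _ _ => G.eval_costFn_nonneg G.load_nonneg)

theorem devCost_nonneg : 0 ≤ G.devCost s u t := G.cost_nonneg

theorem load_update (he : e ∈ t) :
    G.load (Function.update s u t) e = G.loadOn {u}ᶜ s e + G.weight u := by
  rw [G.load_eq_compl_add (R := {u}), loadOn_singleton]
  simp only [Function.update_self, he, if_true]
  congr 1
  exact G.loadOn_congr fun v hv => by simp_all [Function.update_of_ne]

theorem devCost_eq : G.devCost s u t =
    G.weight u * ∑ e ∈ t, (G.costFn e).eval (G.loadOn {u}ᶜ s e + G.weight u) := by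
  simp only [devCost, cost, Function.update_self]
  congr 1
  exact Finset.sum_congr rfl fun e he => by rw [G.load_update he]

variable [Fintype E]

theorem sum_cost_eq : ∑ u ∈ R, G.cost s u =
    ∑ e, G.loadOn R s e * (G.costFn e).eval (G.load s e) :=
  G.sum_weight_mul_sum fun e => (G.costFn e).eval (G.load s e)

theorem sum_cost_le_pot_sub :
    ∑ u ∈ R, G.cost s u ≤ (d + 1) * (G.pot Finset.univ s - G.pot Rᶜ s) := by
  rw [sum_cost_eq, pot, pot, ← Finset.sum_sub_distrib, Finset.mul_sum]
  refine Finset.sum_le_sum fun e _ => ?_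
  have h := Polynomial.mul_eval_le_antideriv_sub (G.costFn_natDegree_le e)
    (G.costFn_coeff_nonneg e) (G.loadOn_nonneg (A := Rᶜ) (s := s) (e := e)) G.loadOn_le_load
  rwa [show G.load s e - G.loadOn Rᶜ s e = G.loadOn R s e by
    rw [G.load_eq_compl_add (R := R)]; ring] at h

theorem pot_sub_pot_sdiff_le (h : B ⊆ A) :
    G.pot A s - G.pot (A \ B) s ≤ ∑ u ∈ B, G.cost s u := by
  rw [sum_cost_eq, pot, pot, ← Finset.sum_sub_distrib]
  refine Finset.sum_le_sum fun e _ => ?_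
  refine (Polynomial.antideriv_sub_le (G.costFn_coeff_nonneg e) G.loadOn_nonneg
    (G.loadOn_mono Finset.sdiff_subset)).trans ?_
  rw [show G.loadOn A s e - G.loadOn (A \ B) s e = G.loadOn B s e by
    rw [← G.loadOn_sdiff_add h]; ring]
  exact mul_le_mul_of_nonneg_left (G.eval_costFn_mono G.loadOn_nonneg G.loadOn_le_load)
    G.loadOn_nonneg

theorem pot_congr (h : ∀ v ∈ A, s v = s' v) : G.pot A s = G.pot A s' :=
  Finset.sum_congr rfl fun _ _ => by rw [G.loadOn_congr h]

/-- A move of a player decreases the potential at least by a fraction of her old cost, minus her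
new cost. -/
theorem cost_le_pot_sub_update : G.cost s u ≤
    (d + 1) * (G.pot Finset.univ s - G.pot Finset.univ (Function.update s u t) +
      G.devCost s u t) := by
  have h1 := G.sum_cost_le_pot_sub (R := {u}) (s := s)
  have h2 := G.pot_sub_pot_sdiff_le (A := Finset.univ) (B := {u}) (s := Function.update s u t)
    (Finset.subset_univ _)
  rw [Finset.sum_singleton] at h1 h2
  rw [← Finset.compl_eq_univ_sdiff, G.pot_congr (A := {u}ᶜ) (s' := s)
    (fun v hv => by simp_all [Function.update_of_ne])] at h2
  refine h1.trans (mul_le_mul_of_nonneg_left ?_ (by positivity))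
  rw [devCost]; linarith

/-- The total cost of deviations of the players in `R` from `s` to a state `s'` that only they can
reach is bounded by a combination of their costs in the two states. -/
theorem sum_devCost_le (h : ∀ v ∉ R, s' v = s v) {T : ℝ} (hT : 0 < T) :
    ∑ u ∈ R, G.devCost s u (s' u) ≤ (1 + T) ^ d * ∑ u ∈ R, G.cost s' u +
      (1 + 1 / T) ^ d / T * ∑ u ∈ R, G.cost s u := by
  have h1 : ∑ u ∈ R, G.devCost s u (s' u) ≤ ∑ u ∈ R, G.weight u *
      ∑ e ∈ s' u, (G.costFn e).eval (G.load s e + G.loadOn R s' e) := by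
    refine Finset.sum_le_sum fun u hu => ?_
    rw [devCost_eq]
    refine mul_le_mul_of_nonneg_left (Finset.sum_le_sum fun e he => ?_) (G.weight_pos u).le
    exact G.eval_costFn_mono (add_nonneg G.loadOn_nonneg (G.weight_pos u).le)
      (add_le_add G.loadOn_le_load (G.weight_le_loadOn hu he))
  refine h1.trans ?_
  rw [G.sum_weight_mul_sum fun e => (G.costFn e).eval (G.load s e + G.loadOn R s' e),
    sum_cost_eq, sum_cost_eq, Finset.mul_sum, Finset.mul_sum, ← Finset.sum_add_distrib]
  refine Finset.sum_le_sum fun e _ => ?_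
  have h2 := Polynomial.mul_eval_add_le (G.costFn_natDegree_le e) (G.costFn_coeff_nonneg e)
    (G.loadOn_nonneg (A := Rᶜ) (s := s) (e := e)) (G.loadOn_nonneg (A := R) (s := s) (e := e))
    (G.loadOn_nonneg (A := R) (s := s') (e := e)) hT
  rw [G.load_eq_compl_add (R := R) (s := s), G.load_eq_compl_add (R := R) (s := s'),
    G.loadOn_congr (A := Rᶜ) (s := s') (s' := s) fun v hv => h v (Finset.mem_compl.1 hv)]
  exact h2

/-- Resourcewise sum of the load-increase inequality. The terms charged to the movers add up to at
most their total cost in `s'`, where they have arrived. -/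
theorem cost_le_of_sum_cost_le (h : ∀ v ∉ R, s' v = s v) (hu : u ∉ R) (hγ : 0 < γ)
    (hD : ∑ v ∈ R, G.cost s' v ≤ D) :
    G.cost s' u ≤ (1 + γ) ^ d * G.cost s u + 1 / γ * D := by
  rw [sum_cost_eq] at hD
  have h1 : ∑ e ∈ s u, G.loadOn R s' e * (G.costFn e).eval (G.load s' e) ≤ D :=
    (Finset.sum_le_sum_of_subset_of_nonneg (Finset.subset_univ _) fun e _ _ =>
      mul_nonneg G.loadOn_nonneg (G.eval_costFn_nonneg G.load_nonneg)).trans hD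
  have h2 : G.cost s' u ≤ (1 + γ) ^ d * G.cost s u +
      1 / γ * ∑ e ∈ s u, G.loadOn R s' e * (G.costFn e).eval (G.load s' e) := by
    simp only [cost, h u hu, Finset.mul_sum, ← Finset.sum_add_distrib]
    refine Finset.sum_le_sum fun e he => ?_
    refine Polynomial.mul_eval_le_of_load_increase (G.costFn_natDegree_le e)
      (G.costFn_coeff_nonneg e) (G.weight_pos u)
      (G.weight_le_loadOn (Finset.mem_univ u) he) G.load_nonneg G.loadOn_nonneg ?_ hγ
    rw [G.load_eq_compl_add (R := R) (s := s'),
      G.loadOn_congr (A := Rᶜ) (s := s') (s' := s) fun v hv => h v (Finset.mem_compl.1 hv)]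
    exact add_le_add_left G.loadOn_le_load _
  refine h2.trans (add_le_add_right (mul_le_mul_of_nonneg_left h1 (by positivity)) _)

/-- Resourcewise sum of the load-decrease inequality. Here the relevant total is that of the movers
in `s`, before they leave. -/
theorem devCost_le_of_sum_cost_le (h : ∀ v ∉ R, s' v = s v) (hu : u ∉ R) (hγ : 0 < γ)
    (hγ1 : γ ≤ 1) (hD : ∑ v ∈ R, G.cost s v ≤ D) :
    G.devCost s u t ≤ (1 + γ) ^ d * G.devCost s' u t +
      d * (1 + γ) ^ d * (1 / γ) ^ d * D := by
  rw [sum_cost_eq] at hD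
  have h1 : ∑ e ∈ t, G.loadOn R s e * (G.costFn e).eval (G.load s e) ≤ D :=
    (Finset.sum_le_sum_of_subset_of_nonneg (Finset.subset_univ _) fun e _ _ =>
      mul_nonneg G.loadOn_nonneg (G.eval_costFn_nonneg G.load_nonneg)).trans hD
  have h2 : G.devCost s u t ≤ (1 + γ) ^ d * G.devCost s' u t + d * (1 + γ) ^ d * (1 / γ) ^ d *
      ∑ e ∈ t, G.loadOn R s e * (G.costFn e).eval (G.load s e) := by
    simp only [devCost_eq, Finset.mul_sum, ← Finset.sum_add_distrib]
    refine Finset.sum_le_sum fun e he => ?_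
    refine Polynomial.mul_eval_le_of_load_decrease (G.costFn_natDegree_le e)
      (G.costFn_coeff_nonneg e) (G.weight_pos u) G.loadOn_nonneg G.loadOn_le_load
      (add_nonneg G.loadOn_nonneg (G.weight_pos u).le)
      (le_add_of_nonneg_left G.loadOn_nonneg) (add_le_add_left G.loadOn_le_load _) ?_ hγ hγ1
    have hR : R ⊆ {u}ᶜ := by
      rw [Finset.subset_compl_comm, Finset.singleton_subset_iff]; simpa using hu
    have e1 := G.loadOn_sdiff_add hR (s := s) (e := e)
    have e2 : G.loadOn ({u}ᶜ \ R) s e = G.loadOn ({u}ᶜ \ R) s' e :=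
      G.loadOn_congr fun v hv => (h v (Finset.mem_sdiff.1 hv).2).symm
    have e3 : G.loadOn ({u}ᶜ \ R) s' e ≤ G.loadOn {u}ᶜ s' e :=
      G.loadOn_mono Finset.sdiff_subset
    linarith
  refine h2.trans (add_le_add_right (mul_le_mul_of_nonneg_left h1 (by positivity)) _)

end

end CongestionGame

/-! ### Costs of the players that move within one phase -/

namespace CongestionGame

noncomputable section

/-- The left side is at most e^(1/4), and 1.285^4 exceeds e. -/
theorem one_add_one_div_pow_le {d : ℕ} (hd : 1 ≤ d) : (1 + 1 / (4 * d : ℝ)) ^ d ≤ 257 / 200 := by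
  have hd0 : (0 : ℝ) < d := by exact_mod_cast hd
  have h1 : (1 + 1 / (4 * d : ℝ)) ^ d ≤ Real.exp (1 / 4) := by
    calc (1 + 1 / (4 * d : ℝ)) ^ d ≤ Real.exp (1 / (4 * d : ℝ)) ^ d := by
          gcongr; rw [add_comm]; exact Real.add_one_le_exp _
      _ = Real.exp (1 / 4) := by rw [← Real.exp_nat_mul]; congr 1; field_simp
  refine h1.trans ?_
  have h2 : Real.exp (1 / 4) ^ 4 = Real.exp 1 := by rw [← Real.exp_nat_mul]; norm_num
  refine le_of_pow_le_pow_left₀ (n := 4) (by norm_num) (by norm_num) ?_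
  rw [h2]
  exact Real.exp_one_lt_d9.le.trans (by norm_num)

theorem pParam_eq (d : ℕ) :
    pParam d = (d + 1) * ((2 * d + 3) * (4 * d) * (4 * (d : ℝ)) ^ d) := by
  rw [pParam, pow_succ]; ring

theorem four_mul_le_pow {d : ℕ} (hd : 1 ≤ d) : 4 ≤ (4 * (d : ℝ)) ^ d := by
  have hd1 : (1 : ℝ) ≤ d := by exact_mod_cast hd
  calc (4 : ℝ) ≤ (4 * d) ^ 1 := by linarith
    _ ≤ _ := pow_le_pow_right₀ (by linarith) hd

theorem mul_le_pParam {d : ℕ} (hd : 1 ≤ d) :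
    20 * d * ((d + 1) * (4 * (d : ℝ)) ^ d) ≤ pParam d := by
  have hd1 : (1 : ℝ) ≤ d := by exact_mod_cast hd
  rw [pParam_eq]
  have h : 0 ≤ d * ((d + 1) * (4 * (d : ℝ)) ^ d) := by positivity
  nlinarith

theorem pParam_ge {d : ℕ} (hd : 1 ≤ d) : 160 ≤ pParam d := by
  have hd1 : (1 : ℝ) ≤ d := by exact_mod_cast hd
  have h2 : 8 ≤ (d + 1) * (4 * (d : ℝ)) ^ d := by nlinarith [four_mul_le_pow hd]
  nlinarith [mul_le_pParam hd]

theorem pParam_ge_mul {d : ℕ} (hd : 1 ≤ d) : 80 * (d + 1 : ℝ) ≤ pParam d := by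
  have hd1 : (1 : ℝ) ≤ d := by exact_mod_cast hd
  have h2 : 4 * (d + 1 : ℝ) ≤ (d + 1) * (4 * (d : ℝ)) ^ d := by nlinarith [four_mul_le_pow hd]
  nlinarith [mul_le_pParam hd]

/-- The potential of the players that move in a phase is at most this number times the boundary of
the phase and the number of players. -/
def phaseConst (d : ℕ) : ℝ := 16 * ((d + 1) * (4 * d) ^ d)

/-- The arithmetic of one phase. `A` and `C` are the movers' total costs at start and end, `Φ₀` and
`Φ₁` the corresponding potentials minus that of the non-movers, `S` the excess of last-move costs
over b/(d+1), and `n` stands for the number of players times b. Eliminating `C` and `S` bounds `A`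
by a multiple of `n` plus 0.9058 `A`, which is absorbed on the left. -/
theorem le_phaseConst_mul {d : ℕ} (hd : 1 ≤ d) {A C Φ₀ Φ₁ S n ρ : ℝ} (hn : 0 ≤ n) (hC : 0 ≤ C)
    (hS : 0 ≤ S) (hρ : ρ = alpha d + 1 / pParam d)
    (hA : A ≤ n + ρ * ((1 + 4 * d) ^ d * C + (1 + 1 / (4 * d : ℝ)) ^ d / (4 * d) * A))
    (hCΦ : C ≤ (d + 1) * Φ₁) (hΦA : Φ₀ ≤ A) (hΦS : Φ₁ ≤ n / (d + 1) + S)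
    (hSΦ : (pParam d / (d + 1) - 1) * S ≤ Φ₀ - Φ₁) : A ≤ phaseConst d * n := by
  have hd1 : (1 : ℝ) ≤ d := by exact_mod_cast hd
  have hd0 : (0 : ℝ) < d := by linarith
  have hp := pParam_ge hd
  have hpe := pParam_eq d
  have hq := four_mul_le_pow hd
  have hE := one_add_one_div_pow_le hd
  set p := pParam d
  set q := (4 * (d : ℝ)) ^ d
  have hl : (1 + 4 * (d : ℝ)) ^ d ≤ 257 / 200 * q := by
    calc (1 + 4 * (d : ℝ)) ^ d = (1 + 1 / (4 * d : ℝ)) ^ d * q := by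
          rw [← mul_pow]; congr 1; field_simp; ring
      _ ≤ _ := by gcongr
  have ha : (0 : ℝ) < d + 1 := by linarith
  have hΦ1 : 0 ≤ Φ₁ := by
    by_contra! h; nlinarith
  have hP : p / (d + 1) = (2 * d + 3) * (4 * d) * q := by rw [hpe]; field_simp
  have hP80 : 80 ≤ p / (d + 1) := by rw [hP]; nlinarith [mul_le_mul hd1 hq (by norm_num) hd0.le]
  set P := p / (d + 1)
  have hPpos : 0 < P := by linarith
  have hSA : S ≤ 80 / 79 * (A / P) := by
    have h1 : 79 / 80 * P * S ≤ A := by nlinarith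
    rw [mul_div_assoc', le_div_iff₀ hPpos]; linarith
  have hA0 : 0 ≤ A := by nlinarith
  have hρle : ρ ≤ 321 / 320 * (d + 1) := by
    rw [hρ, alpha]
    have : 1 / p ≤ 1 / 160 := one_div_le_one_div_of_le (by norm_num) hp
    linarith
  have hρ0 : 0 ≤ ρ := by rw [hρ, alpha]; positivity
  -- The worst case is d = 1, where (d+1)/d = 2.
  have hμ : ρ * ((1 + 1 / (4 * d : ℝ)) ^ d / (4 * d) * A) ≤ 6446 / 10000 * A := by
    calc ρ * ((1 + 1 / (4 * d : ℝ)) ^ d / (4 * d) * A)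
        ≤ (321 / 320 * (d + 1)) * ((257 / 200) / (4 * d) * A) := by gcongr
      _ = (321 / 320 * 257 / 200 / 4) * ((d + 1) / d) * A := by field_simp
      _ ≤ (321 / 320 * 257 / 200 / 4) * 2 * A := by
          gcongr
          rw [div_le_iff₀ hd0]; linarith
      _ ≤ _ := by nlinarith
  have hC' : C ≤ n + (d + 1) * (80 / 79 * (A / P)) := by
    calc C ≤ (d + 1) * (n / (d + 1) + 80 / 79 * (A / P)) :=
          hCΦ.trans (mul_le_mul_of_nonneg_left (hΦS.trans (by linarith)) ha.le)
      _ = _ := by field_simp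
  have hlam : ρ * ((1 + 4 * d) ^ d * C) ≤
      1290 / 1000 * ((d + 1) * q) * n + 2612 / 10000 * A := by
    have hfrac : ((d : ℝ) + 1) * ((d + 1) * q) / P ≤ 1 / 5 := by
      rw [div_le_iff₀ hPpos, hP]
      -- The claim amounts to 5(d+1)² ≤ 4d(2d+3), and the difference factors as (d-1)(3d+5).
      have : 0 ≤ q * ((d - 1) * (3 * d + 5)) := by
        have : 0 ≤ (d : ℝ) - 1 := by linarith
        positivity
      nlinarith
    calc ρ * ((1 + 4 * d) ^ d * C)
        ≤ (321 / 320 * (d + 1)) * ((257 / 200 * q) * (n + (d + 1) * (80 / 79 * (A / P)))) := by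
          gcongr
      _ = 321 / 320 * (257 / 200) * ((d + 1) * q) * n + 321 / 320 * (257 / 200) * (80 / 79) *
            (((d : ℝ) + 1) * ((d + 1) * q) / P) * A := by field_simp
      _ ≤ 1290 / 1000 * ((d + 1) * q) * n + 321 / 320 * (257 / 200) * (80 / 79) * (1 / 5) * A := by
          gcongr; norm_num
      _ ≤ _ := by nlinarith
  have h1 : n ≤ 1 / 8 * ((d + 1) * q) * n := by
    have : 1 ≤ 1 / 8 * ((d + 1) * q) := by nlinarith
    nlinarith
  -- What remains on the left is 0.0942 `A`, against (1.290 + 0.125)(d+1)q `n`; the quotient of the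
  -- constants is just above 15, hence the 16 in `phaseConst`.
  rw [mul_add] at hA
  rw [phaseConst]
  linarith

variable {d : ℕ} {N E : Type*} [Fintype N] [DecidableEq N] [Fintype E] [DecidableEq E]
  (G : CongestionGame d N E) {s s₀ : N → Finset E} {u : N} {t : Finset E} {b : ℝ} {F : Set N}

/-- The invariant of a phase with boundary `b` and fixed players `F` that started in `s₀`, where
`R` are the players that have moved and `T` bounds their costs just after their last moves. -/
def PhaseInv (b : ℝ) (F : Set N) (s₀ s : N → Finset E) : Prop :=
  ∃ (R : Finset N) (T : N → ℝ), (∀ u, 0 ≤ T u) ∧ (∀ u ∈ R, u ∉ F) ∧ (∀ u ∉ R, s u = s₀ u) ∧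
    (∀ Q, G.pot Q s - G.pot (Q \ R) s ≤ ∑ u ∈ Q, T u) ∧
    (pParam d / (d + 1) - 1) * ∑ u, max (T u - b / (d + 1)) 0 ≤
      G.pot Finset.univ s₀ - G.pot Finset.univ s

theorem PhaseInv.refl (hb : 0 ≤ b) : G.PhaseInv b F s₀ s₀ := by
  refine ⟨∅, fun _ => 0, fun _ => le_rfl, by simp, by simp, by simp, ?_⟩
  have : ((0 : ℝ) - b / (d + 1)) ≤ 0 := by
    have : 0 ≤ b / ((d : ℝ) + 1) := by positivity
    linarith
  simp only [max_eq_right this]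
  simp

variable {G}

/-- The mover's entry of `T` becomes her new cost. The potential bound is kept for all sets Q so
that she can be split off: her marginal potential is at most her new cost, and the rest does not see
her move. If she was cheaper than b, her new cost has no excess; after a p-move the excess is paid
for by the potential drop. Her previous excess is simply discarded. -/
theorem PhaseInv.update (h : G.PhaseInv b F s₀ s) (hd : 1 ≤ d) (hb : 0 ≤ b) (hu : u ∉ F)
    (hmove : (G.cost s u < b ∧ (d + 1) * G.devCost s u t ≤ G.cost s u) ∨
      pParam d * G.devCost s u t ≤ G.cost s u) :
    G.PhaseInv b F s₀ (Function.update s u t) := by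
  obtain ⟨R, T, hT, hRF, hR, hpot, hsum⟩ := h
  have ha : (0 : ℝ) < d + 1 := by positivity
  have hpa : 0 ≤ pParam d / (d + 1) - 1 := by
    rw [sub_nonneg, le_div_iff₀ ha]; linarith [pParam_ge_mul hd]
  have hdev := G.devCost_nonneg (s := s) (u := u) (t := t)
  refine ⟨insert u R, Function.update T u (G.devCost s u t), fun v => ?_, fun v hv => ?_,
    fun v hv => ?_, fun Q => ?_, ?_⟩
  · rcases eq_or_ne v u with rfl | hv
    · simpa using hdev
    · simpa [hv] using hT v
  · rcases Finset.mem_insert.1 hv with rfl | hv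
    exacts [hu, hRF v hv]
  · rw [Finset.mem_insert, not_or] at hv
    rw [Function.update_of_ne hv.1, hR v hv.2]
  · have hcongr : ∀ Q : Finset N, u ∉ Q → G.pot Q (Function.update s u t) = G.pot Q s :=
      fun Q hQ => G.pot_congr fun v hv =>
        Function.update_of_ne (ne_of_mem_of_not_mem hv hQ) _ _
    have hQ' : G.pot (Q \ {u}) (Function.update s u t) -
        G.pot (Q \ insert u R) (Function.update s u t) ≤ ∑ v ∈ Q \ {u}, T v := by
      rw [hcongr _ (by simp), hcongr _ (by simp)]
      have := hpot (Q \ {u})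
      rwa [sdiff_sdiff, Finset.sup_eq_union, Finset.singleton_union] at this
    have hsumT : ∑ v ∈ Q \ {u}, T v = ∑ v ∈ Q \ {u}, Function.update T u (G.devCost s u t) v :=
      Finset.sum_congr rfl fun v hv => by
        rw [Function.update_of_ne (by simpa using (Finset.mem_sdiff.1 hv).2)]
    rw [hsumT] at hQ'
    by_cases hQ : u ∈ Q
    · have h1 := G.pot_sub_pot_sdiff_le (s := Function.update s u t)
        (Finset.singleton_subset_iff.2 hQ)
      rw [Finset.sum_singleton] at h1
      rw [← Finset.sum_sdiff (Finset.singleton_subset_iff.2 hQ), Finset.sum_singleton,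
        Function.update_self, devCost]
      rw [devCost] at hQ'
      linarith
    · rwa [Finset.sdiff_singleton_eq_erase, Finset.erase_eq_of_notMem hQ] at hQ'
  · have hdrop := G.cost_le_pot_sub_update (s := s) (u := u) (t := t)
    have h1 : ∑ v, max (Function.update T u (G.devCost s u t) v - b / (d + 1)) 0 ≤
        ∑ v, max (T v - b / (d + 1)) 0 + max (G.devCost s u t - b / (d + 1)) 0 := by
      have h3 : ∑ v, (if v = u then max (G.devCost s u t - b / (d + 1)) 0 else 0) =
          max (G.devCost s u t - b / (d + 1)) 0 := by simp
      rw [← h3, ← Finset.sum_add_distrib]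
      refine Finset.sum_le_sum fun v _ => ?_
      rcases eq_or_ne v u with rfl | hv
      · simp
      · simp [hv]
    have h2 : (pParam d / (d + 1) - 1) * max (G.devCost s u t - b / (d + 1)) 0 ≤
        G.pot Finset.univ s - G.pot Finset.univ (Function.update s u t) := by
      rcases hmove with ⟨hlt, hm⟩ | hm
      · have : G.devCost s u t - b / (d + 1) ≤ 0 := by
          rw [sub_nonpos, le_div_iff₀ ha]; linarith
        rw [max_eq_right this, mul_zero]
        by_contra! hneg
        nlinarith
      · have h3 : max (G.devCost s u t - b / (d + 1)) 0 ≤ G.devCost s u t :=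
          max_le (sub_le_self _ (by positivity)) hdev
        have h4 : pParam d / (d + 1) * G.devCost s u t ≤
            G.pot Finset.univ s - G.pot Finset.univ (Function.update s u t) +
              G.devCost s u t := by
          rw [div_mul_eq_mul_div, div_le_iff₀' ha]; exact hm.trans hdrop
        nlinarith [mul_le_mul_of_nonneg_left h3 hpa]
    nlinarith [mul_le_mul_of_nonneg_left h1 hpa]

/-- The players that move in a phase have small total costs at its start and at its end if at its
start they have small costs or no profitable moves. -/
theorem PhaseInv.exists_sum_cost_le (h : G.PhaseInv b F s₀ s) (hd : 1 ≤ d) (hb : 0 ≤ b)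
    (hs : G.IsState s)
    (hstart : ∀ u ∉ F, G.cost s₀ u < b ∨ ¬ G.HasMove (alpha d + 1 / pParam d) s₀ u) :
    ∃ R : Finset N, (∀ u ∈ R, u ∉ F) ∧ (∀ u ∉ R, s u = s₀ u) ∧
      ∑ u ∈ R, G.cost s₀ u ≤ phaseConst d * (Fintype.card N * b) ∧
      ∑ u ∈ R, G.cost s u ≤ (d + 1) * (phaseConst d * (Fintype.card N * b)) := by
  obtain ⟨R, T, hT, hRF, hR, hpot, hsum⟩ := h
  have hd1 : (1 : ℝ) ≤ d := by exact_mod_cast hd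
  have ha : (0 : ℝ) < d + 1 := by positivity
  have hp := pParam_ge hd
  have hcompl : G.pot Rᶜ s = G.pot Rᶜ s₀ :=
    G.pot_congr fun v hv => hR v (Finset.mem_compl.1 hv)
  have hρ0 : 0 ≤ alpha d + 1 / pParam d := by rw [alpha]; positivity
  have hnonneg : 0 ≤ ∑ u, max (T u - b / (d + 1)) 0 :=
    Finset.sum_nonneg fun _ _ => le_max_right _ _
  have hpa : 0 ≤ pParam d / (d + 1) - 1 := by
    rw [sub_nonneg, le_div_iff₀ ha]; linarith [pParam_ge_mul hd]
  have hA : ∑ u ∈ R, G.cost s₀ u ≤ Fintype.card N * b + (alpha d + 1 / pParam d) *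
      ((1 + 4 * d) ^ d * ∑ u ∈ R, G.cost s u +
        (1 + 1 / (4 * d : ℝ)) ^ d / (4 * d) * ∑ u ∈ R, G.cost s₀ u) := by
    have h1 : ∑ u ∈ R, G.cost s₀ u ≤
        ∑ u ∈ R, (b + (alpha d + 1 / pParam d) * G.devCost s₀ u (s u)) := by
      refine Finset.sum_le_sum fun u hu => ?_
      have hdev := mul_nonneg hρ0 (G.devCost_nonneg (s := s₀) (u := u) (t := s u))
      rcases hstart u (hRF u hu) with hlt | hno
      · linarith
      · have : ¬ _ < _ := fun hlt => hno ⟨s u, hs u, hlt⟩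
        linarith
    refine h1.trans ?_
    rw [Finset.sum_add_distrib, ← Finset.mul_sum, Finset.sum_const, nsmul_eq_mul]
    -- With T = 4d the coefficient of the start total, multiplied by ρ ≈ d+1, stays below 1.
    refine add_le_add ?_ (mul_le_mul_of_nonneg_left
      (G.sum_devCost_le hR (T := 4 * d) (by linarith)) hρ0)
    exact mul_le_mul_of_nonneg_right (by exact_mod_cast Finset.card_le_univ R) hb
  have hC := G.sum_cost_le_pot_sub (R := R) (s := s)
  have hΦA := G.pot_sub_pot_sdiff_le (s := s₀) (Finset.subset_univ R)
  rw [← Finset.compl_eq_univ_sdiff, ← hcompl] at hΦA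
  have hΦS : G.pot Finset.univ s - G.pot Rᶜ s ≤
      Fintype.card N * b / (d + 1) + ∑ u, max (T u - b / (d + 1)) 0 := by
    have h1 := hpot Finset.univ
    rw [← Finset.compl_eq_univ_sdiff] at h1
    have h2 : ∑ u, T u ≤ ∑ u, (b / (d + 1) + max (T u - b / (d + 1)) 0) :=
      Finset.sum_le_sum fun u _ => by linarith [le_max_left (T u - b / (d + 1)) 0]
    rw [Finset.sum_add_distrib, Finset.sum_const, nsmul_eq_mul, Finset.card_univ] at h2
    rw [mul_div_assoc]
    exact h1.trans h2
  have hle := le_phaseConst_mul hd (n := Fintype.card N * b) (by positivity)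
    (Finset.sum_nonneg fun u _ => G.cost_nonneg) hnonneg rfl hA hC hΦA hΦS (by linarith)
  refine ⟨R, hRF, hR, hle, hC.trans (mul_le_mul_of_nonneg_left ?_ ha.le)⟩
  have := mul_nonneg hpa hnonneg
  linarith

end

end CongestionGame

/-! ### Fixed players through the later phases -/

namespace CongestionGame

noncomputable section

variable {d : ℕ} {N E : Type*} [Fintype N] [DecidableEq N] [Nonempty N] [Fintype E]
  [DecidableEq E] (G : CongestionGame d N E) (β : ℝ) (sInit : N → Finset E)
  {s s₀ : N → Finset E} {u : N} {t : Finset E} {F : Set N} {k : ℕ}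

/-- The reciprocal of the relative load change on a resource that is negligible in a phase. -/
def loadRatio : ℝ := d * (1 + G.numPhases β sInit * (1 + pParam d))

/-- The factor by which negligible load changes may change a cost in a phase. -/
def phaseFactor : ℝ := (1 + 1 / G.loadRatio β sInit) ^ d

/-- The rate at which the cost of a fixed player may increase, relative to the boundary. -/
def incRate : ℝ :=
  G.loadRatio β sInit * ((d + 1) * (phaseConst d * Fintype.card N)) / (G.gParam β sInit - 1)

/-- The rate at which the deviation costs of a fixed player may decrease, relative to the
boundary. -/
def decRate : ℝ :=
  d * G.phaseFactor β sInit * G.loadRatio β sInit ^ d * (phaseConst d * Fintype.card N) /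
    (G.gParam β sInit - 1)

variable {β sInit}

theorem phaseConst_nonneg : 0 ≤ phaseConst d := by rw [phaseConst]; positivity

theorem mul_phaseConst_le (hd : 1 ≤ d) : d * phaseConst d ≤ 16 / 20 * pParam d := by
  rw [phaseConst]; linarith [mul_le_pParam hd]

theorem phaseConst_le (hd : 1 ≤ d) : phaseConst d ≤ pParam d := by
  have hd1 : (1 : ℝ) ≤ d := by exact_mod_cast hd
  nlinarith [mul_phaseConst_le hd, phaseConst_nonneg (d := d), pParam_ge hd]

theorem one_le_loadRatio (hd : 1 ≤ d) : 1 ≤ G.loadRatio β sInit := by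
  have hd1 : (1 : ℝ) ≤ d := by exact_mod_cast hd
  have hp := pParam_ge hd
  have : (0 : ℝ) ≤ G.numPhases β sInit * (1 + pParam d) := by positivity
  rw [loadRatio]; nlinarith

theorem gParam_sub_one :
    G.gParam β sInit - 1 = Fintype.card N * pParam d ^ 3 * G.loadRatio β sInit ^ d := by
  rw [gParam, loadRatio, mul_pow]; ring

theorem one_le_card : (1 : ℝ) ≤ Fintype.card N := by exact_mod_cast Fintype.card_pos (α := N)

theorem ten_le_gParam_sub_one (hd : 1 ≤ d) : 10 ≤ G.gParam β sInit - 1 := by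
  have hp := pParam_ge hd
  have h2 := one_le_pow₀ (n := d) (G.one_le_loadRatio (β := β) (sInit := sInit) hd)
  have h3 : (160 : ℝ) ^ 3 ≤ pParam d ^ 3 := pow_le_pow_left₀ (by norm_num) hp 3
  rw [gParam_sub_one]
  calc (10 : ℝ) ≤ 1 * 160 ^ 3 * 1 := by norm_num
    _ ≤ _ := by
      gcongr
      exact one_le_card

theorem one_le_phaseFactor (hd : 1 ≤ d) : 1 ≤ G.phaseFactor β sInit := by
  have h := G.one_le_loadRatio (β := β) (sInit := sInit) hd
  exact one_le_pow₀ (le_add_of_nonneg_right (by positivity))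

/-- With 1+x ≤ exp x the m-fold product is at most exp(m/(1+m(1+p))) ≤ exp(1/(1+p)), and exp(-x) ≥
1-x turns this into 1+1/p. `loadRatio` is chosen for this. -/
theorem phaseFactor_pow_le (hd : 1 ≤ d) (hm : 1 ≤ G.numPhases β sInit)
    (hk : k ≤ G.numPhases β sInit) : G.phaseFactor β sInit ^ k ≤ 1 + 1 / pParam d := by
  have hd1 : (1 : ℝ) ≤ d := by exact_mod_cast hd
  have hp := pParam_ge hd
  have hm1 : (1 : ℝ) ≤ G.numPhases β sInit := by exact_mod_cast hm
  refine (pow_le_pow_right₀ (G.one_le_phaseFactor hd) hk).trans ?_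
  rw [phaseFactor, loadRatio, ← pow_mul]
  set m := G.numPhases β sInit
  set p := pParam d
  calc (1 + 1 / (d * (1 + m * (1 + p)))) ^ (d * m)
      ≤ Real.exp (1 / (d * (1 + m * (1 + p)))) ^ (d * m) := by
        gcongr; rw [add_comm]; exact Real.add_one_le_exp _
    _ = Real.exp (m / (1 + m * (1 + p))) := by
        rw [← Real.exp_nat_mul]; congr 1; push_cast; field_simp
    _ ≤ Real.exp (1 / (1 + p)) := by
        rw [Real.exp_le_exp, div_le_div_iff₀ (by positivity) (by positivity)]; linarith
    _ ≤ 1 + 1 / p := by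
        have h1 := Real.add_one_le_exp (-(1 / (1 + p)))
        rw [Real.exp_neg] at h1
        have h2 : -(1 / (1 + p)) + 1 = p / (1 + p) := by field_simp; ring
        rw [h2] at h1
        have h3 := inv_anti₀ (by positivity) h1
        rw [inv_inv] at h3
        refine h3.trans (le_of_eq ?_)
        rw [inv_div, add_div, div_self (by positivity), add_comm]

theorem incRate_nonneg (hd : 1 ≤ d) : 0 ≤ G.incRate β sInit := by
  have h := G.one_le_loadRatio (β := β) (sInit := sInit) hd
  have := G.ten_le_gParam_sub_one (β := β) (sInit := sInit) hd
  have := phaseConst_nonneg (d := d)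
  rw [incRate]; positivity

theorem decRate_nonneg (hd : 1 ≤ d) : 0 ≤ G.decRate β sInit := by
  have h := G.one_le_loadRatio (β := β) (sInit := sInit) hd
  have := G.ten_le_gParam_sub_one (β := β) (sInit := sInit) hd
  have := phaseConst_nonneg (d := d)
  have := G.one_le_phaseFactor (β := β) (sInit := sInit) hd
  rw [decRate]; positivity

theorem incRate_le (hd : 1 ≤ d) : G.incRate β sInit ≤ 1 / pParam d := by
  have hp := pParam_ge hd
  have hK := phaseConst_le hd
  have hK0 := phaseConst_nonneg (d := d)
  have hpa : (d + 1 : ℝ) ≤ pParam d := by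
    have := pParam_ge_mul hd
    have : (0 : ℝ) ≤ d := by positivity
    linarith
  have hM := G.one_le_loadRatio (β := β) (sInit := sInit) hd
  have hMd : G.loadRatio β sInit ≤ G.loadRatio β sInit ^ d := le_self_pow₀ hM (by omega)
  have hn := one_le_card (N := N)
  rw [incRate, gParam_sub_one, div_le_div_iff₀ (by positivity) (by positivity), one_mul]
  set M := G.loadRatio β sInit
  set p := pParam d
  calc M * ((d + 1) * (phaseConst d * Fintype.card N)) * p
      ≤ M ^ d * (p * (p * Fintype.card N)) * p := by gcongr
    _ = _ := by ring

theorem decRate_mul_le (hd : 1 ≤ d) (hm : 1 ≤ G.numPhases β sInit) :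
    G.decRate β sInit * (pParam d * (pParam d + 1)) ≤ 1 := by
  have hp := pParam_ge hd
  have hK := mul_phaseConst_le hd
  have hK0 := phaseConst_nonneg (d := d)
  have hM := G.one_le_loadRatio (β := β) (sInit := sInit) hd
  have hn := one_le_card (N := N)
  have hG := G.phaseFactor_pow_le hd hm hm
  rw [pow_one] at hG
  rw [decRate, gParam_sub_one, div_mul_eq_mul_div, div_le_one (by positivity)]
  set M := G.loadRatio β sInit
  set p := pParam d
  have h1 : (1 : ℝ) / p ≤ 1 / 160 := one_div_le_one_div_of_le (by norm_num) hp
  calc d * G.phaseFactor β sInit * M ^ d * (phaseConst d * Fintype.card N) * (p * (p + 1))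
      = G.phaseFactor β sInit * (d * phaseConst d) * (M ^ d * Fintype.card N * (p * (p + 1))) := by
        ring
    _ ≤ (1 + 1 / p) * (16 / 20 * p) * (M ^ d * Fintype.card N * (p * (p + 1))) := by
        gcongr
    _ = (16 / 20 * (1 + 1 / p) ^ 2) * (Fintype.card N * p ^ 3 * M ^ d) := by
        field_simp
    _ ≤ 1 * (Fintype.card N * p ^ 3 * M ^ d) := by
        gcongr
        nlinarith [show 0 ≤ 1 / p by positivity]
    _ = _ := one_mul _

theorem cMin_le_cost (hs : G.IsState s) (u : N) : G.cMin ≤ G.cost s u := by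
  have h1 : G.cMin ≤ G.devCost (fun _ => ∅) u (s u) :=
    (Finset.inf'_le _ (Finset.mem_univ u)).trans (Finset.inf'_le _ (hs u))
  refine h1.trans ?_
  rw [devCost_eq, cost]
  refine mul_le_mul_of_nonneg_left (Finset.sum_le_sum fun e he => ?_) (G.weight_pos u).le
  refine G.eval_costFn_mono (add_nonneg G.loadOn_nonneg (G.weight_pos u).le) ?_
  rw [show G.loadOn {u}ᶜ (fun _ => ∅) e = 0 by simp [loadOn], zero_add]
  exact G.weight_le_loadOn (Finset.mem_univ u) he

theorem cMax_pos (hc : 0 < G.cMin) (hs : G.IsState sInit) : 0 < G.cMax sInit := by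
  obtain ⟨u⟩ := ‹Nonempty N›
  exact (hc.trans_le (G.cMin_le_cost hs u)).trans_le
    (Finset.le_sup' (G.cost sInit) (Finset.mem_univ u))

theorem boundary_nonneg (hd : 1 ≤ d) (hc : 0 < G.cMin) (hs : G.IsState sInit) :
    0 ≤ G.boundary β sInit k := by
  have := G.ten_le_gParam_sub_one (β := β) (sInit := sInit) hd
  have := G.cMax_pos hc hs
  have : 0 < G.gParam β sInit := by linarith
  rw [boundary]; positivity

/-- Rewrites an error proportional to the next boundary as a difference of boundaries, so that the
errors of successive phases telescope. -/
theorem boundary_succ (hd : 1 ≤ d) : G.boundary β sInit (k + 1) =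
    (G.boundary β sInit k - G.boundary β sInit (k + 1)) / (G.gParam β sInit - 1) := by
  have := G.ten_le_gParam_sub_one (β := β) (sInit := sInit) hd
  have h1 : G.gParam β sInit - 1 ≠ 0 := by linarith
  have h2 : G.gParam β sInit ≠ 0 := by linarith
  rw [eq_div_iff h1, boundary, boundary, pow_succ]
  field_simp

theorem boundary_succ_le (hd : 1 ≤ d) (hc : 0 < G.cMin) (hs : G.IsState sInit) :
    G.boundary β sInit (k + 1) ≤ G.boundary β sInit k := by
  have h0 := G.boundary_nonneg (β := β) (k := k + 1) hd hc hs
  have h1 := G.ten_le_gParam_sub_one (β := β) (sInit := sInit) hd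
  have h2 := G.boundary_succ (β := β) (sInit := sInit) (k := k) hd
  rw [eq_div_iff (by linarith)] at h2
  nlinarith

/-- Here β ≤ 10 matters: g ≥ 11 dominates the base of the logarithm, so g^k ≥ β^k ≥ c_max/c_min. -/
theorem boundary_le_cMin (hd : 1 ≤ d) (hc : 0 < G.cMin) (hs : G.IsState sInit) (hβ : 1 < β)
    (hβ' : β ≤ 10) (hk : G.numPhases β sInit ≤ k) : G.boundary β sInit k ≤ G.cMin := by
  have hg := G.ten_le_gParam_sub_one (β := β) (sInit := sInit) hd
  have hc' := G.cMax_pos hc hs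
  have h1 : G.cMax sInit / G.cMin ≤ G.gParam β sInit ^ k := by
    calc G.cMax sInit / G.cMin = β ^ Real.logb β (G.cMax sInit / G.cMin) :=
          (Real.rpow_logb (by linarith) hβ.ne' (by positivity)).symm
      _ ≤ β ^ (k : ℝ) := by
          refine Real.rpow_le_rpow_of_exponent_le hβ.le ((Nat.le_ceil _).trans ?_)
          exact_mod_cast hk
      _ = β ^ k := Real.rpow_natCast _ _
      _ ≤ _ := pow_le_pow_left₀ (by linarith) (by linarith) k
  rw [div_le_iff₀ hc] at h1
  have : 0 < G.gParam β sInit ^ k := pow_pos (by linarith) k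
  rw [boundary, inv_mul_le_iff₀ this]
  exact h1

variable (β sInit)

/-- The invariant of a fixed player at the end of phase `k`: relative to the cost `c` that she had
when she was fixed, her cost has not increased much and her deviation costs are not too small. -/
def FixInv (k : ℕ) (s : N → Finset E) (u : N) : Prop :=
  ∃ c b : ℝ, b ≤ c ∧ G.boundary β sInit k ≤ b ∧
    G.cost s u ≤ G.phaseFactor β sInit ^ k *
      (c + G.incRate β sInit * (b - G.boundary β sInit k)) ∧
    ∀ t ∈ G.strategies u, c ≤ pParam d * (G.phaseFactor β sInit ^ k *
      (G.devCost s u t + G.decRate β sInit * (b - G.boundary β sInit k)))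

variable {β sInit} {G}

theorem FixInv.of_not_hasMove (hd : 1 ≤ d) (hb : G.boundary β sInit k ≤ G.cost s u)
    (hno : ¬ G.HasMove (pParam d) s u) : G.FixInv β sInit k s u := by
  have hG := one_le_pow₀ (n := k) (G.one_le_phaseFactor (β := β) (sInit := sInit) hd)
  have hp := pParam_ge hd
  refine ⟨G.cost s u, G.boundary β sInit k, hb, le_rfl, ?_, fun t ht => ?_⟩
  · rw [sub_self, mul_zero, add_zero]
    exact le_mul_of_one_le_left G.cost_nonneg hG
  · rw [sub_self, mul_zero, add_zero]
    have h1 : G.cost s u ≤ pParam d * G.devCost s u t := by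
      by_contra! h; exact hno ⟨t, ht, h⟩
    exact h1.trans (mul_le_mul_of_nonneg_left
      (le_mul_of_one_le_left G.devCost_nonneg hG) (by linarith))

/-- A fixed player is not among the movers, so the two charging inequalities apply with γ =
1/`loadRatio`: the end total of the movers bounds the increase of her cost, their start total the
decrease of her deviation costs. -/
theorem FixInv.succ (h : G.FixInv β sInit k s₀ u) (hd : 1 ≤ d) (hc : 0 < G.cMin)
    (hInit : G.IsState sInit) (hs : G.IsState s) (hu : u ∈ F)
    (hstart : ∀ u ∉ F, G.cost s₀ u < G.boundary β sInit (k + 1) ∨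
      ¬ G.HasMove (alpha d + 1 / pParam d) s₀ u)
    (hphase : G.PhaseInv (G.boundary β sInit (k + 1)) F s₀ s) :
    G.FixInv β sInit (k + 1) s u := by
  have hp := pParam_ge hd
  have hM := G.one_le_loadRatio (β := β) (sInit := sInit) hd
  have hb0 := G.boundary_nonneg (β := β) (k := k + 1) hd hc hInit
  have hbs := G.boundary_succ_le (β := β) (k := k) hd hc hInit
  obtain ⟨R, hRF, hR, hD, hD'⟩ := hphase.exists_sum_cost_le hd hb0 hs hstart
  have huR : u ∉ R := fun h => hRF u h hu
  have hγ : 0 < 1 / G.loadRatio β sInit := by positivity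
  have hγ1 : 1 / G.loadRatio β sInit ≤ 1 := by rw [div_le_one (by linarith)]; exact hM
  have hinc := G.cost_le_of_sum_cost_le hR huR hγ hD'
  have hdec := fun t => G.devCost_le_of_sum_cost_le (t := t) hR huR hγ hγ1 hD
  have hG := G.one_le_phaseFactor (β := β) (sInit := sInit) hd
  have hGk := one_le_pow₀ (n := k) hG
  have hg := G.ten_le_gParam_sub_one (β := β) (sInit := sInit) hd
  have hi0 := G.incRate_nonneg (β := β) (sInit := sInit) hd
  have hd0 := G.decRate_nonneg (β := β) (sInit := sInit) hd
  simp only [one_div_one_div] at hinc hdec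
  have e1 : G.loadRatio β sInit * ((d + 1) * (phaseConst d *
      (Fintype.card N * G.boundary β sInit (k + 1)))) = G.incRate β sInit *
        (G.boundary β sInit k - G.boundary β sInit (k + 1)) := by
    conv_lhs => rw [G.boundary_succ hd]
    rw [incRate]; ring
  have e2 : d * (1 + 1 / G.loadRatio β sInit) ^ d * G.loadRatio β sInit ^ d * (phaseConst d *
      (Fintype.card N * G.boundary β sInit (k + 1))) = G.decRate β sInit *
        (G.boundary β sInit k - G.boundary β sInit (k + 1)) := by
    conv_lhs => rw [G.boundary_succ hd]
    rw [decRate, phaseFactor]; ring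
  rw [e1] at hinc
  simp only [e2] at hdec
  rw [← phaseFactor] at hinc hdec
  obtain ⟨c, b, hbc, hbk, hcost, hdev⟩ := h
  rw [FixInv]
  generalize G.boundary β sInit k = b₀ at *
  generalize G.boundary β sInit (k + 1) = b₁ at *
  generalize G.incRate β sInit = κ at *
  generalize G.decRate β sInit = κ' at *
  generalize G.phaseFactor β sInit = g at *
  refine ⟨c, b, hbc, hbs.trans hbk, ?_, fun t ht => (hdev t ht).trans ?_⟩
  · have h1 : κ * (b₀ - b₁) ≤ g ^ (k + 1) * (κ * (b₀ - b₁)) :=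
      le_mul_of_one_le_left (mul_nonneg hi0 (sub_nonneg.2 hbs)) (one_le_pow₀ hG)
    calc G.cost s u ≤ g * (g ^ k * (c + κ * (b - b₀))) + g ^ (k + 1) * (κ * (b₀ - b₁)) :=
          hinc.trans (add_le_add (mul_le_mul_of_nonneg_left hcost (by linarith)) h1)
      _ = _ := by ring
  · refine mul_le_mul_of_nonneg_left ?_ (by linarith)
    have h0 : 0 ≤ κ' * (b - b₁) := mul_nonneg hd0 (by linarith)
    calc g ^ k * (G.devCost s₀ u t + κ' * (b - b₀))
        ≤ g ^ k * (g * G.devCost s u t + κ' * (b₀ - b₁) + κ' * (b - b₀)) := by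
          gcongr; exact hdec t
      _ = g ^ k * (g * G.devCost s u t + κ' * (b - b₁)) := by ring
      _ ≤ g ^ k * (g * G.devCost s u t + g * (κ' * (b - b₁))) := by
          gcongr g ^ k * (_ + ?_); exact le_mul_of_one_le_left h0 hG
      _ = _ := by ring

/-- Since b ≤ c, the telescoped errors are at most multiples of c. This gives a cost of at most
(1+1/p)²c ≤ (1+3/p)c, and (1-1/p)c ≤ (1+1/p)p v for the deviation cost v, hence (1-2/p)c ≤ p v. -/
theorem FixInv.cost_le (h : G.FixInv β sInit k s u) (hd : 1 ≤ d) (hc : 0 < G.cMin)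
    (hInit : G.IsState sInit) (hm : 1 ≤ G.numPhases β sInit) (hk : k ≤ G.numPhases β sInit)
    (ht : t ∈ G.strategies u) : G.cost s u ≤ approxFactor d * G.devCost s u t := by
  obtain ⟨c, b, hbc, hbk, hcost, hdev⟩ := h
  have hp := pParam_ge hd
  have hdev := hdev t ht
  have hv := G.devCost_nonneg (s := s) (u := u) (t := t)
  have hb0 := G.boundary_nonneg (β := β) (k := k) hd hc hInit
  have hGk := G.phaseFactor_pow_le hd hm hk
  have hGk1 := one_le_pow₀ (n := k) (G.one_le_phaseFactor (β := β) (sInit := sInit) hd)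
  have hi0 := G.incRate_nonneg (β := β) (sInit := sInit) hd
  have hd0 := G.decRate_nonneg (β := β) (sInit := sInit) hd
  have hi := G.incRate_le (β := β) (sInit := sInit) hd
  have hdr := G.decRate_mul_le hd hm
  rw [approxFactor]
  generalize G.boundary β sInit k = b₀ at *
  generalize G.incRate β sInit = κ at *
  generalize G.decRate β sInit = κ' at *
  generalize G.phaseFactor β sInit ^ k = g at *
  generalize G.devCost s u t = v at *
  generalize pParam d = p at *
  have hc0 : 0 ≤ c := by linarith
  have hp0 : 0 < p := by linarith
  have hq : 1 / p ≤ 1 / 160 := one_div_le_one_div_of_le (by norm_num) hp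
  have hq0 : 0 < 1 / p := by positivity
  have h1 : G.cost s u ≤ (1 + 3 / p) * c := by
    calc G.cost s u ≤ g * (c + κ * (b - b₀)) := hcost
      _ ≤ (1 + 1 / p) * (c + 1 / p * c) := by
          gcongr
          linarith
      _ = (1 + 1 / p) ^ 2 * c := by ring
      _ ≤ (1 + 3 / p) * c := by
          gcongr
          rw [show 3 / p = 3 * (1 / p) by ring]
          nlinarith
  have h2 : (1 - 2 / p) * c ≤ p * v := by
    have h3 : c ≤ p * ((1 + 1 / p) * (v + κ' * c)) := by
      refine hdev.trans ?_
      gcongr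
      linarith
    have h4 : p * ((1 + 1 / p) * (v + κ' * c)) = (p + 1) * v + (κ' * (p * (p + 1))) * (1 / p) * c := by
      field_simp
    have h5 : κ' * (p * (p + 1)) * (1 / p) * c ≤ 1 * (1 / p) * c := by gcongr
    have h6 : (1 - 1 / p) * c ≤ (p + 1) * v := by linarith
    have h7 : (p + 1) * v = (1 + 1 / p) * (p * v) := by field_simp
    have h8 : (1 + 1 / p) * ((1 - 2 / p) * c) ≤ (1 - 1 / p) * c := by
      have : (1 + 1 / p) * (1 - 2 / p) ≤ 1 - 1 / p := by
        rw [show 2 / p = 2 * (1 / p) by ring]; nlinarith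
      nlinarith
    exact le_of_mul_le_mul_left (h8.trans (h6.trans h7.le)) (by positivity)
  have h3 : 0 < 1 - 2 / p := by
    rw [show 2 / p = 2 * (1 / p) by ring]; linarith
  calc G.cost s u ≤ (1 + 3 / p) * c := h1
    _ ≤ (1 + 3 / p) * (p * v / (1 - 2 / p)) := by
        gcongr
        rw [le_div_iff₀ h3]; linarith
    _ = _ := by ring

end

end CongestionGame

/-! ### Invariants of the whole run, correctness and termination -/

namespace CongestionGame

noncomputable section

variable {d : ℕ} {N E : Type*} [Fintype N] [DecidableEq N] [Nonempty N] [Fintype E]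
  [DecidableEq E] (G : CongestionGame d N E) (β : ℝ) (sInit : N → Finset E)
  {s s₀ : N → Finset E} {u : N} {t : Finset E} {F : Set N} {i k : ℕ}

/-- The invariant at the end of phase `k`, where `F` are the players fixed so far. -/
def EndInv (k : ℕ) (s : N → Finset E) (F : Set N) : Prop :=
  G.IsState s ∧ (∀ u ∈ F, 1 ≤ k ∧ G.FixInv β sInit k s u) ∧
    ∀ u ∉ F, G.cost s u < G.boundary β sInit (k + 1) ∨
      ¬ G.HasMove (alpha d + 1 / pParam d) s u

/-- The invariant of the configurations of the algorithm. -/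
def ConfigInv : Config N E → Prop
  | .running 0 s F => G.IsState s ∧ F = ∅
  | .running (i + 1) s F => i + 1 < G.numPhases β sInit ∧ G.IsState s ∧
      ∃ s₀, G.EndInv β sInit i s₀ F ∧ G.PhaseInv (G.boundary β sInit (i + 1)) F s₀ s
  | .halted s _ => ∃ k F, k ≤ G.numPhases β sInit ∧ G.numPhases β sInit ≤ k + 1 ∧
      G.EndInv β sInit k s F

variable {G β sInit}

theorem IsState.update (hs : G.IsState s) (ht : t ∈ G.strategies u) :
    G.IsState (Function.update s u t) := by
  intro v
  rcases eq_or_ne v u with rfl | hv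
  · simpa using ht
  · simpa [hv] using hs v

theorem HasMove.mul_devCost_lt {ρ : ℝ} (h : G.HasMove ρ s u) (hρ : 0 ≤ ρ)
    (ht : G.IsBestResponse s u t) : ρ * G.devCost s u t < G.cost s u := by
  obtain ⟨t', ht', hlt⟩ := h
  exact (mul_le_mul_of_nonneg_left (ht.2 t' ht') hρ).trans_lt hlt

theorem ConfigInv.endInv (h : G.ConfigInv β sInit (.running i s F)) (hd : 1 ≤ d)
    (hc : 0 < G.cMin) (hInit : G.IsState sInit) (hsel : ∀ u, ¬ G.Selectable β sInit i s F u) :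
    G.EndInv β sInit i s (G.fixedAfter β sInit i s F) := by
  rcases i with _ | i
  · obtain ⟨hs, rfl⟩ := h
    refine ⟨hs, by simp [fixedAfter], fun u _ => ?_⟩
    have := hsel u
    simp only [Selectable, not_and] at this
    exact (lt_or_ge _ _).imp_right this
  · obtain ⟨hi, hs, s₀, ⟨hs₀, hfix, hstart⟩, hphase⟩ := h
    refine ⟨hs, fun u hu => ⟨Nat.succ_pos i, ?_⟩, fun u hu => ?_⟩
    · rcases hu with hu | ⟨hu, hb⟩
      · exact (hfix u hu).2.succ hd hc hInit hs hu hstart hphase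
      · exact .of_not_hasMove hd hb fun hmove => hsel u ⟨hu, Or.inr ⟨hb, hmove⟩⟩
    · simp only [fixedAfter, addFixed, Set.mem_union, Set.mem_ofPred_eq, not_or, not_and,
        not_le] at hu
      by_contra! hcon
      exact hsel u ⟨hu.1, Or.inl ⟨hcon.1, hu.2 hu.1, hcon.2⟩⟩

theorem alpha_add_le_pParam (hd : 1 ≤ d) : alpha d + 1 / pParam d ≤ pParam d := by
  have hp := pParam_ge hd
  have hd1 : (1 : ℝ) ≤ d := by exact_mod_cast hd
  have : 1 / pParam d ≤ 1 / 160 := one_div_le_one_div_of_le (by norm_num) hp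
  have := pParam_ge_mul hd
  rw [alpha]; linarith

theorem alpha_add_pos (hd : 1 ≤ d) : 0 < alpha d + 1 / pParam d := by
  have hp := pParam_ge hd
  rw [alpha]; positivity

theorem pParam_le_approxFactor {d : ℕ} (hd : 1 ≤ d) : pParam d ≤ approxFactor d := by
  have hp := pParam_ge hd
  have hq : 1 / pParam d ≤ 1 / 160 := one_div_le_one_div_of_le (by norm_num) hp
  have hq0 : 0 < 1 / pParam d := by positivity
  rw [approxFactor]
  refine le_mul_of_one_le_left (by linarith) ?_
  rw [show 2 / pParam d = 2 * (1 / pParam d) by ring,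
    show 3 / pParam d = 3 * (1 / pParam d) by ring, le_div_iff₀ (by linarith)]
  linarith

theorem ConfigInv.step {c c' : Config N E} (h : G.ConfigInv β sInit c) (hd : 1 ≤ d)
    (hc : 0 < G.cMin) (hInit : G.IsState sInit) (hstep : G.Step β sInit c c') :
    G.ConfigInv β sInit c' := by
  have hp := pParam_ge hd
  cases hstep with
  | move i s F u t hu ht =>
    rcases i with _ | i
    · exact ⟨h.1.update ht.1, h.2⟩
    · obtain ⟨hi, hs, s₀, hend, hphase⟩ := h
      refine ⟨hi, hs.update ht.1, s₀, hend,
        hphase.update hd (G.boundary_nonneg hd hc hInit) hu.1 ?_⟩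
      rcases hu.2 with ⟨-, hlt, hmove⟩ | ⟨-, hmove⟩
      · refine Or.inl ⟨hlt, le_trans ?_ (hmove.mul_devCost_lt (alpha_add_pos hd).le ht).le⟩
        refine mul_le_mul_of_nonneg_right ?_ G.devCost_nonneg
        rw [alpha]
        exact le_add_of_nonneg_right (by positivity)
      · exact Or.inr (hmove.mul_devCost_lt (by linarith) ht).le
  | nextPhase i s F hs hi =>
    have hend := h.endInv hd hc hInit hs
    exact ⟨hi, hend.1, s, hend, .refl _ (G.boundary_nonneg hd hc hInit)⟩
  | halt i s F hs hi =>
    -- The witness is the fixed set before the final addition, which does not affect the returned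
    -- state. Phase 0 runs even if `numPhases` is 0, so i ≤ m needs a separate argument there.
    refine ⟨i, _, ?_, hi, h.endInv hd hc hInit hs⟩
    rcases i with _ | i
    exacts [Nat.zero_le _, h.1.le]

theorem EndInv.isApproxEquilibrium (h : G.EndInv β sInit k s F) (hd : 1 ≤ d)
    (hc : 0 < G.cMin) (hInit : G.IsState sInit) (hβ : 1 < β) (hβ' : β ≤ 10)
    (hk : k ≤ G.numPhases β sInit) (hk' : G.numPhases β sInit ≤ k + 1) :
    G.IsApproxEquilibrium (approxFactor d) s := by
  obtain ⟨hs, hfix, hfree⟩ := h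
  refine ⟨hs, fun u t ht => ?_⟩
  by_cases hu : u ∈ F
  · obtain ⟨h1, h2⟩ := hfix u hu
    exact h2.cost_le hd hc hInit (h1.trans hk) hk ht
  · have hb := (G.boundary_le_cMin hd hc hInit hβ hβ' hk').trans (G.cMin_le_cost hs u)
    have hno := (hfree u hu).resolve_left hb.not_gt
    have h1 : G.cost s u ≤ (alpha d + 1 / pParam d) * G.devCost s u t := by
      by_contra! h; exact hno ⟨t, ht, h⟩
    exact h1.trans (mul_le_mul_of_nonneg_right
      ((alpha_add_le_pParam hd).trans (pParam_le_approxFactor hd)) G.devCost_nonneg)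

theorem Returns.isApproxEquilibrium (h : G.Returns β sInit s) (hd : 1 ≤ d)
    (hc : 0 < G.cMin) (hInit : G.IsState sInit) (hβ : 1 < β) (hβ' : β ≤ 10) :
    G.IsApproxEquilibrium (approxFactor d) s := by
  obtain ⟨F, hF⟩ := h
  have key : ∀ c, Relation.ReflTransGen (G.Step β sInit) (.running 0 sInit ∅) c →
      G.ConfigInv β sInit c := by
    intro c hcc
    induction hcc with
    | refl => exact ⟨hInit, rfl⟩
    | tail _ hstep ih => exact ih.step hd hc hInit hstep
  obtain ⟨k, F', hk, hk', hend⟩ := key _ hF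
  exact hend.isApproxEquilibrium hd hc hInit hβ hβ' hk hk'

theorem Selectable.pot_update_lt (hd : 1 ≤ d) (hu : G.Selectable β sInit i s F u)
    (ht : G.IsBestResponse s u t) :
    G.pot Finset.univ (Function.update s u t) < G.pot Finset.univ s := by
  have hp := pParam_ge hd
  have hdev := G.devCost_nonneg (s := s) (u := u) (t := t)
  have hα := alpha_add_pos hd
  have key : (alpha d + 1 / pParam d) * G.devCost s u t < G.cost s u := by
    rcases i with _ | i
    · exact hu.2.mul_devCost_lt hα.le ht
    · rcases hu.2 with ⟨-, -, hmove⟩ | ⟨-, hmove⟩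
      · exact hmove.mul_devCost_lt hα.le ht
      · exact (mul_le_mul_of_nonneg_right (alpha_add_le_pParam hd) hdev).trans_lt
          (hmove.mul_devCost_lt (by linarith) ht)
  have h1 := G.cost_le_pot_sub_update (s := s) (u := u) (t := t)
  have h2 : 0 ≤ 1 / pParam d * G.devCost s u t := by positivity
  rw [alpha] at key
  have h3 : 0 < (d + 1) * (G.pot Finset.univ s - G.pot Finset.univ (Function.update s u t)) := by
    linarith
  exact sub_pos.1 (pos_of_mul_pos_right h3 (by positivity))

/-- Within a phase the potential strictly decreases on a finite set of profiles; accessibility of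
the next phase, if there is one, is the hypothesis `hnext`. -/
theorem acc_running_of_succ (hd : 1 ≤ d)
    (hnext : i + 1 < G.numPhases β sInit →
      ∀ s F, Acc (fun c' c => G.Step β sInit c c') (.running (i + 1) s F))
    (s : N → Finset E) (F : Set N) :
    Acc (fun c' c => G.Step β sInit c c') (.running i s F) := by
  have wf : WellFounded fun s' s : N → Finset E =>
      G.pot Finset.univ s' < G.pot Finset.univ s :=
    @Finite.wellFounded_of_trans_of_irrefl _ _ _ ⟨fun _ _ _ => lt_trans⟩ ⟨fun _ => lt_irrefl _⟩
  induction s using wf.induction with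
  | _ s ih =>
    refine ⟨_, fun c' hstep => ?_⟩
    cases hstep with
    | move _ _ _ u t hu ht => exact ih _ (hu.pot_update_lt hd ht)
    | nextPhase _ _ _ _ hi => exact hnext hi _ _
    | halt _ _ _ _ _ => exact ⟨_, fun _ hstep => by cases hstep⟩

theorem terminates (hd : 1 ≤ d) : G.Terminates β sInit := by
  -- Induction on a bound `j` for the number of remaining phases.
  have key : ∀ j i, G.numPhases β sInit ≤ i + j → ∀ s F,
      Acc (fun c' c => G.Step β sInit c c') (.running i s F) := by
    intro j
    induction j with
    | zero => exact fun i hi => acc_running_of_succ hd fun h => by omega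
    | succ j ih => exact fun i hi => acc_running_of_succ hd fun _ => ih (i + 1) (by omega)
  exact key _ 0 (Nat.zero_add _).ge sInit ∅

theorem exists_isBestResponse (s : N → Finset E) (u : N) : ∃ t, G.IsBestResponse s u t :=
  Finset.exists_min_image _ _ (G.strategies_nonempty u)

theorem exists_step (i : ℕ) (s : N → Finset E) (F : Set N) :
    ∃ c, G.Step β sInit (.running i s F) c := by
  by_cases h : ∃ u, G.Selectable β sInit i s F u
  · obtain ⟨u, hu⟩ := h
    obtain ⟨t, ht⟩ := G.exists_isBestResponse s u
    exact ⟨_, .move i s F u t hu ht⟩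
  · push Not at h
    rcases lt_or_ge (i + 1) (G.numPhases β sInit) with hi | hi
    exacts [⟨_, .nextPhase i s F h hi⟩, ⟨_, .halt i s F h hi⟩]

/-- No running configuration is stuck, so following steps along the accessibility proof must reach a
halted one. -/
theorem exists_returns (hd : 1 ≤ d) : ∃ s, G.Returns β sInit s := by
  have key : ∀ c, Acc (fun c' c => G.Step β sInit c c') c →
      ∃ s F, Relation.ReflTransGen (G.Step β sInit) c (.halted s F) := by
    intro c hacc
    induction hacc with
    | intro c _ ih =>
      cases c with
      | halted s F => exact ⟨s, F, .refl⟩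
      | running i s F =>
        obtain ⟨c', hc'⟩ := G.exists_step (β := β) (sInit := sInit) i s F
        obtain ⟨s', F', h⟩ := ih c' hc'
        exact ⟨s', F', .head hc' h⟩
  exact key _ (terminates hd)

end

end CongestionGame

/-! ### Asymptotics of the approximation factor -/

namespace CongestionGame

theorem approxFactor_le {d : ℕ} (hd : 1 ≤ d) : approxFactor d ≤ 2 * pParam d := by
  have hp := pParam_ge hd
  have hq : 1 / pParam d ≤ 1 / 160 := one_div_le_one_div_of_le (by norm_num) hp
  rw [approxFactor]
  refine mul_le_mul_of_nonneg_right ?_ (by linarith)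
  rw [show 2 / pParam d = 2 * (1 / pParam d) by ring,
    show 3 / pParam d = 3 * (1 / pParam d) by ring, div_le_iff₀ (by linarith)]
  linarith

theorem pow_le_approxFactor {d : ℕ} (hd : 1 ≤ d) : (d : ℝ) ^ d ≤ approxFactor d := by
  have hd1 : (1 : ℝ) ≤ d := by exact_mod_cast hd
  refine le_trans ?_ ((mul_le_pParam hd).trans (pParam_le_approxFactor hd))
  calc (d : ℝ) ^ d ≤ (4 * (d : ℝ)) ^ d := pow_le_pow_left₀ (by linarith) (by linarith) d
    _ ≤ 20 * d * ((d + 1) * (4 * (d : ℝ)) ^ d) := by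
      rw [← mul_assoc]
      exact le_mul_of_one_le_left (by positivity) (by nlinarith)

theorem approxFactor_le_pow {d : ℕ} (hd : 1 ≤ d) :
    approxFactor d ≤ 80 * 4 ^ d * (d : ℝ) ^ (d + 3) := by
  have hd1 : (1 : ℝ) ≤ d := by exact_mod_cast hd
  refine (approxFactor_le hd).trans ?_
  rw [pParam_eq]
  calc 2 * ((d + 1) * ((2 * d + 3) * (4 * d) * (4 * (d : ℝ)) ^ d))
      ≤ 2 * ((d + d) * ((2 * d + 3 * d) * (4 * d) * (4 * (d : ℝ)) ^ d)) := by
        gcongr; linarith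
    _ = _ := by rw [mul_pow]; ring

/-- The second-order term of the logarithm of `approxFactor` to the base `d`. -/
noncomputable def approxExponentError (d : ℕ) : ℝ :=
  Real.logb d (approxFactor d) - d

theorem approxFactor_eq_rpow {d : ℕ} (hd : 2 ≤ d) :
    approxFactor d = (d : ℝ) ^ ((d : ℝ) + approxExponentError d) := by
  have hd1 : (2 : ℝ) ≤ d := by exact_mod_cast hd
  have h : 0 < approxFactor d :=
    (pow_pos (by linarith) d).trans_le (pow_le_approxFactor (by omega))
  rw [approxExponentError, add_sub_cancel, Real.rpow_logb (by linarith) (by linarith) h]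

theorem approxExponentError_nonneg {d : ℕ} (hd : 2 ≤ d) : 0 ≤ approxExponentError d := by
  have hd1 : (2 : ℝ) ≤ d := by exact_mod_cast hd
  have h := pow_le_approxFactor (d := d) (by omega)
  have h0 : (0 : ℝ) < d ^ d := pow_pos (by linarith) d
  rw [approxExponentError, sub_nonneg,
    Real.le_logb_iff_rpow_le (by linarith) (h0.trans_le h), Real.rpow_natCast]
  exact h

theorem approxExponentError_le {d : ℕ} (hd : 2 ≤ d) :
    approxExponentError d ≤ 3 + (Real.log 80 + d * Real.log 4) / Real.log d := by
  have hd1 : (2 : ℝ) ≤ d := by exact_mod_cast hd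
  have h0 : 0 < approxFactor d :=
    (pow_pos (by linarith) d).trans_le (pow_le_approxFactor (by omega))
  have hlog : 0 < Real.log d := Real.log_pos (by linarith)
  have h := Real.log_le_log h0 (approxFactor_le_pow (by omega))
  rw [Real.log_mul (by positivity) (by positivity), Real.log_mul (by norm_num) (by positivity),
    Real.log_pow, Real.log_pow] at h
  rw [approxExponentError, Real.logb, sub_le_iff_le_add, div_le_iff₀ hlog]
  push_cast at h
  refine h.trans (le_of_eq ?_)
  field_simp
  ring

/-- The bounds d^d ≤ ρ_d ≤ 80·4^d·d^(d+3) place the error between 0 and 3 + (log 80 + d log 4)/log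
d, which is O(d/log d). -/
theorem approxExponentError_isLittleO :
    approxExponentError =o[atTop] (fun d : ℕ => (d : ℝ)) := by
  have hcast : Tendsto (fun d : ℕ => (d : ℝ)) atTop atTop := tendsto_natCast_atTop_atTop
  have hlog : Tendsto (fun d : ℕ => Real.log d) atTop atTop :=
    Real.tendsto_log_atTop.comp hcast
  rw [isLittleO_iff_tendsto' (by
    filter_upwards [eventually_ge_atTop 1] with d hd h
    exact absurd h (by positivity))]
  have hbound : Tendsto (fun d : ℕ => 3 / (d : ℝ) + Real.log 80 / d / Real.log d +
      Real.log 4 / Real.log d) atTop (nhds 0) := by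
    have h1 : Tendsto (fun d : ℕ => 3 / (d : ℝ)) atTop (nhds 0) := hcast.const_div_atTop 3
    have h2 : Tendsto (fun d : ℕ => Real.log 80 / (d : ℝ) / Real.log d) atTop (nhds 0) :=
      (hcast.const_div_atTop _).div_atTop hlog
    have h3 : Tendsto (fun d : ℕ => Real.log 4 / Real.log d) atTop (nhds 0) :=
      hlog.const_div_atTop _
    simpa using (h1.add h2).add h3
  refine tendsto_of_tendsto_of_tendsto_of_le_of_le' tendsto_const_nhds hbound ?_ ?_
  · filter_upwards [eventually_ge_atTop 2] with d hd
    exact div_nonneg (approxExponentError_nonneg hd) (by positivity)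
  · filter_upwards [eventually_ge_atTop 2] with d hd
    have hd1 : (2 : ℝ) ≤ d := by exact_mod_cast hd
    have hlog : 0 < Real.log d := Real.log_pos (by linarith)
    rw [div_le_iff₀ (by linarith)]
    refine (approxExponentError_le hd).trans (le_of_eq ?_)
    field_simp
    ring

end CongestionGame

theorem mainTheorem4 :
    (∃ ε : ℕ → ℝ, ε =o[atTop] (fun d : ℕ => (d : ℝ)) ∧
      ∀ d : ℕ, 2 ≤ d → CongestionGame.approxFactor d = (d : ℝ) ^ ((d : ℝ) + ε d)) ∧
    ∀ (d : ℕ), 1 ≤ d →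
    ∀ (N E : Type*) [Fintype N] [DecidableEq N] [Nonempty N] [Fintype E] [DecidableEq E]
      (G : CongestionGame d N E), 0 < G.cMin →
    ∀ (β : ℝ), 1 < β → β ≤ 10 →
    ∀ (sInit : N → Finset E), G.IsState sInit →
      G.Terminates β sInit ∧
      (∃ s, G.Returns β sInit s) ∧
      ∀ s, G.Returns β sInit s →
        G.IsApproxEquilibrium (CongestionGame.approxFactor d) s :=
  ⟨⟨_, CongestionGame.approxExponentError_isLittleO,
    fun _ hd => CongestionGame.approxFactor_eq_rpow hd⟩,
  fun _ hd _ _ _ _ _ _ _ _ hc _ hβ hβ' _ hInit =>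
    ⟨CongestionGame.terminates hd, CongestionGame.exists_returns hd,
      fun _ hs => hs.isApproxEquilibrium hd hc hInit hβ hβ'⟩⟩
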